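/- Let $\Gamma$ be a monoid (for instance a group). A $2$-dimensional representation of $\Gamma$ on a scheme $X$ is a monoid homomorphism $\rho:\Gamma\to \mathrm{M}_2(\Gamma(X,\mathcal{O}_X))$. Two such representations $\rho_1,\rho_2$ are equivalent, $\rho_1\sim\rho_2$, if there is a $\Gamma(X,\mathcal{O}_X)$-algebra automorphism $\sigma$ of $\mathrm{M}_2(\Gamma(X,\mathcal{O}_X))$ with $\sigma(\rho_1(\gamma))=\rho_2(\gamma)$ for all $\gamma\in\Gamma$. A subsheaf of $\mathcal{O}_X$-algebras $\mathcal{A}\subseteq \mathrm{M}_2(\mathcal{O}_X)$ is a rank $2$ mold if $\mathrm{M}_2(\mathcal{O}_X)/\mathcal{A}$ is locally free and $\mathcal{A}$ is locally free of rank $2$; over a scheme $X$ over $\mathbb{Z}[1/2]$ a rank $2$ mold $\mathcal A$ is unipotent if $\mathrm{tr}(s)^2-4\det(s)=0$ for every open $U\subseteq X$ and every $s\in\mathcal{A}(U)$. A representation $\rho$ has unipotent mold if the subsheaf of $\mathcal{O}_X$-algebras $\mathcal{O}_X[\rho(\Gamma)]\subseteq \mathrm{M}_2(\mathcal{O}_X)$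 generated by $\rho(\Gamma)$ is a unipotent mold. Let $\mathcal{E}q\,\mathcal{U}_2(\Gamma)$ be the sheafification, for the Zariski topology, of the functor $$(\mathbf{Sch}/\mathbb{Z}[1/2])^{op}\to(\mathbf{Sets}),\qquad X\mapsto\{\text{2-dimensional representations of }\Gamma\text{ on }X\text{ with unipotent mold}\}/\sim .$$ Let $A_1(\Gamma)[1/2]$ be the coordinate ring of the affine $\mathbb{Z}[1/2]$-scheme $\mathrm{Rep}_1(\Gamma)[1/2]$ representing $X\mapsto \mathrm{Hom}_{\rm monoid}(\Gamma,\Gamma(X,\mathcal{O}_X))$, with universal character $\chi:\Gamma\to A_1(\Gamma)[1/2]$. Let $\Omega_\Gamma$ be the universal module of derivations relative to $\chi$, that is, the $A_1(\Gamma)[1/2]$-module generated by symbols $d\gamma$ ($\gamma\in\Gamma$) subject to the relations $d(\gamma\delta)=\chi(\gamma)\,d\delta+\chi(\delta)\,d\gamma$. Let $S(\Omega_\Gamma)$ be its symmetric algebra over $A_1(\Gamma)[1/2]$, graded by degree, and put $\mathrm{Ch}_2(\Gamma)_u:=\mathrm{Proj}\,S(\Omega_\Gamma)$, a scheme over $\mathrm{Rep}_1(\Gamma)[1/2]$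 and hence over $\mathbb{Z}[1/2]$. Theorem. The $\mathbb{Z}[1/2]$-scheme $\mathrm{Ch}_2(\Gamma)_u$ represents the functor $\mathcal{E}q\,\mathcal{U}_2(\Gamma)$. It is separated over $\mathbb{Z}[1/2]$, and if $\Gamma$ is finitely generated (as a group or a monoid), then it is of finite type over $\mathbb{Z}[1/2]$. -/

import Mathlib

open CategoryTheory AlgebraicGeometry TopologicalSpace Opposite

universe u

noncomputable section

namespace UnipotentMold

/-! ### Matrices over rings of sections -/

section Algebra

variable {R S : Type*} [CommRing R] [CommRing S] {n : ℕ}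

/-- `m(s) = tr(s)² - 4 det(s)`, the discriminant of the characteristic polynomial. -/
def m (s : Matrix (Fin 2) (Fin 2) R) : R := s.trace ^ 2 - 4 * s.det

theorem m_map (φ : R →+* S) (s : Matrix (Fin 2) (Fin 2) R) : m (φ.mapMatrix s) = φ (m s) := by
  have h4 : φ 4 = 4 := map_ofNat φ 4
  simp [m, Matrix.trace_fin_two, Matrix.det_fin_two, h4]

theorem m_comb (b c : Matrix (Fin 2) (Fin 2) R) (x y : R) (hb : m b = 0) (hc : m c = 0)
    (hbc : m (b + c) = 0) : m (x • b + y • c) = 0 := by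
  simp only [m, Matrix.trace_fin_two, Matrix.det_fin_two, Matrix.add_apply, Matrix.smul_apply,
    smul_eq_mul] at *
  linear_combination (x ^ 2 - x * y) * hb + (y ^ 2 - x * y) * hc + x * y * hbc

theorem mapMatrix_smul (φ : R →+* S) (c : R) (s : Matrix (Fin n) (Fin n) R) :
    φ.mapMatrix (c • s) = φ c • φ.mapMatrix s := by
  ext i j
  simp

theorem mapMatrix_mem_adjoin (φ : R →+* S) {T : Set (Matrix (Fin n) (Fin n) R)}
    {s : Matrix (Fin n) (Fin n) R} (hs : s ∈ Algebra.adjoin R T) :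
    φ.mapMatrix s ∈ Algebra.adjoin S (φ.mapMatrix '' T) := by
  induction hs using Algebra.adjoin_induction with
  | mem x hx => exact Algebra.subset_adjoin ⟨x, hx, rfl⟩
  | algebraMap r =>
    rw [Algebra.algebraMap_eq_smul_one, mapMatrix_smul, map_one]
    exact Subalgebra.smul_mem _ (Subalgebra.one_mem _) _
  | add x y _ _ hx hy => rw [map_add]; exact Subalgebra.add_mem _ hx hy
  | mul x y _ _ hx hy => rw [map_mul]; exact Subalgebra.mul_mem _ hx hy

/-- The representation obtained by applying `φ : R → S` to all matrix entries. -/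
def mapRep {G : Type*} [Monoid G] (φ : R →+* S) (ρ : G →* Matrix (Fin n) (Fin n) R) :
    G →* Matrix (Fin n) (Fin n) S :=
  φ.mapMatrix.toMonoidHom.comp ρ

variable (R S n) in
/-- Scalar extension of a matrix algebra along `R → S`. -/
def matrixBaseChange [Algebra R S] :
    TensorProduct R S (Matrix (Fin n) (Fin n) R) ≃ₐ[S] Matrix (Fin n) (Fin n) S :=
  AlgEquiv.ofRingEquiv (f := (matrixEquivTensor (Fin n) R S).symm.toRingEquiv) (by
    intro r
    change (matrixEquivTensor (Fin n) R S).symm (r ⊗ₜ 1) = _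
    rw [matrixEquivTensor_apply_symm]
    simp [Algebra.algebraMap_eq_smul_one])

theorem matrixBaseChange_one_tmul [Algebra R S] (s : Matrix (Fin n) (Fin n) R) :
    matrixBaseChange R S n (1 ⊗ₜ[R] s) = (algebraMap R S).mapMatrix s := by
  change (matrixEquivTensor (Fin n) R S).symm (1 ⊗ₜ s) = _
  rw [matrixEquivTensor_apply_symm]
  simp

theorem exists_algEquiv_map (φ : R →+* S)
    (σ : Matrix (Fin n) (Fin n) R ≃ₐ[R] Matrix (Fin n) (Fin n) R) :
    ∃ τ : Matrix (Fin n) (Fin n) S ≃ₐ[S] Matrix (Fin n) (Fin n) S,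
      ∀ s, τ (φ.mapMatrix s) = φ.mapMatrix (σ s) := by
  let _ := φ.toAlgebra
  refine ⟨(matrixBaseChange R S n).symm.trans
    ((Algebra.TensorProduct.congr (AlgEquiv.refl : S ≃ₐ[S] S) σ).trans (matrixBaseChange R S n)), ?_⟩
  intro s
  have h (t : Matrix (Fin n) (Fin n) R) :
    matrixBaseChange R S n (1 ⊗ₜ[R] t) = φ.mapMatrix t := matrixBaseChange_one_tmul t
  rw [← h, ← h]
  simp

theorem exists_basis_map (φ : R →+* S) {ι : Type*}
    (B : Module.Basis ι R (Matrix (Fin n) (Fin n) R)) :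
    ∃ B' : Module.Basis ι S (Matrix (Fin n) (Fin n) S), ∀ i, B' i = φ.mapMatrix (B i) := by
  let _ := φ.toAlgebra
  refine ⟨(B.baseChange S).map (matrixBaseChange R S n).toLinearEquiv, fun i => ?_⟩
  rw [Module.Basis.map_apply, Module.Basis.baseChange_apply]
  exact matrixBaseChange_one_tmul (B i)

/-- The subalgebra generated by the image of `ρ` is spanned by the first `r` members of `B`. -/
def Splits {G : Type*} [Monoid G] (ρ : G →* Matrix (Fin n) (Fin n) R) {r q : ℕ}
    (B : Module.Basis (Fin r ⊕ Fin q) R (Matrix (Fin n) (Fin n) R)) : Prop :=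
  Subalgebra.toSubmodule (Algebra.adjoin R (Set.range ρ)) =
    Submodule.span R (Set.range fun i => B (Sum.inl i))

theorem Splits.map {G : Type*} [Monoid G] {ρ : G →* Matrix (Fin n) (Fin n) R} {r q : ℕ}
    {B : Module.Basis (Fin r ⊕ Fin q) R (Matrix (Fin n) (Fin n) R)} (hB : Splits ρ B)
    (φ : R →+* S) (B' : Module.Basis (Fin r ⊕ Fin q) S (Matrix (Fin n) (Fin n) S))
    (h : ∀ i, B' i = φ.mapMatrix (B i)) :
    Splits (mapRep φ ρ) B' := by
  have hrange : Set.range (mapRep φ ρ) =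
      φ.mapMatrix '' Set.range ρ := by
    rw [← Set.range_comp]; rfl
  have key : ∀ x ∈ Submodule.span R (Set.range fun i => B (Sum.inl i)),
      φ.mapMatrix x ∈ Submodule.span S (Set.range fun i => B' (Sum.inl i)) := by
    intro x hx
    induction hx using Submodule.span_induction with
    | mem x hx =>
      obtain ⟨i, rfl⟩ := hx
      exact Submodule.subset_span ⟨i, h _⟩
    | zero => rw [map_zero]; exact Submodule.zero_mem _
    | add x y _ _ hx hy => rw [map_add]; exact Submodule.add_mem _ hx hy
    | smul c x _ hx => rw [mapMatrix_smul]; exact Submodule.smul_mem _ _ hx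
  have memB (x) (hx : x ∈ Algebra.adjoin R (Set.range ρ)) :
      φ.mapMatrix x ∈ Submodule.span S (Set.range fun i => B' (Sum.inl i)) :=
    key x (by rw [← hB]; exact hx)
  apply le_antisymm
  · intro x hx
    change x ∈ Algebra.adjoin _ _ at hx
    rw [hrange] at hx
    induction hx using Algebra.adjoin_induction with
    | mem x hx =>
      obtain ⟨x, hx, rfl⟩ := hx
      exact memB x (Algebra.subset_adjoin hx)
    | algebraMap r =>
      rw [Algebra.algebraMap_eq_smul_one, ← map_one φ.mapMatrix]
      exact Submodule.smul_mem _ _ (memB 1 (Subalgebra.one_mem _))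
    | add x y _ _ hx hy => exact Submodule.add_mem _ hx hy
    | mul x y hx' hy' hx hy =>
      clear hx' hy'
      induction hx using Submodule.span_induction with
      | mem x hx =>
        induction hy using Submodule.span_induction with
        | mem y hy =>
          obtain ⟨i, rfl⟩ := hx
          obtain ⟨j, rfl⟩ := hy
          have hi (i : Fin r) : B (Sum.inl i) ∈ Algebra.adjoin R (Set.range ρ) := by
            have : B (Sum.inl i) ∈ Submodule.span R (Set.range fun i => B (Sum.inl i)) :=
              Submodule.subset_span ⟨i, rfl⟩
            rwa [← hB] at this
          beta_reduce
          rw [h (Sum.inl i), h (Sum.inl j), ← map_mul]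
          exact memB _ (Subalgebra.mul_mem _ (hi i) (hi j))
        | zero => rw [mul_zero]; exact Submodule.zero_mem _
        | add y z _ _ hy hz => rw [mul_add]; exact Submodule.add_mem _ hy hz
        | smul c y _ hy => rw [mul_smul_comm]; exact Submodule.smul_mem _ _ hy
      | zero => rw [zero_mul]; exact Submodule.zero_mem _
      | add x z _ _ hx hz => rw [add_mul]; exact Submodule.add_mem _ hx hz
      | smul c x _ hx => rw [smul_mul_assoc]; exact Submodule.smul_mem _ _ hx
  · rw [Submodule.span_le]
    rintro _ ⟨i, rfl⟩
    have : B (Sum.inl i) ∈ Submodule.span R (Set.range fun i => B (Sum.inl i)) :=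
      Submodule.subset_span ⟨i, rfl⟩
    rw [← hB] at this
    change B' (Sum.inl i) ∈ Algebra.adjoin _ _
    rw [hrange, h]
    exact mapMatrix_mem_adjoin φ this

theorem repr_map (φ : R →+* S) {ι : Type*} [Fintype ι]
    (B : Module.Basis ι R (Matrix (Fin n) (Fin n) R))
    (B' : Module.Basis ι S (Matrix (Fin n) (Fin n) S)) (h : ∀ i, B' i = φ.mapMatrix (B i))
    (s : Matrix (Fin n) (Fin n) R) (i : ι) :
    B'.repr (φ.mapMatrix s) i = φ (B.repr s i) := by
  classical
  have h1 : φ.mapMatrix s = ∑ k, φ (B.repr s k) • B' k := by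
    conv_lhs => rw [← B.sum_repr s]
    rw [map_sum]
    exact Finset.sum_congr rfl fun k _ => by rw [mapMatrix_smul, h]
  rw [h1, B'.repr_sum_self]

/-- Two complementary families with unique coordinates form a basis. -/
theorem exists_basis_of_coords {r q : ℕ} (N : Submodule R (Matrix (Fin n) (Fin n) R))
    (b : Fin r → Matrix (Fin n) (Fin n) R) (e : Fin q → Matrix (Fin n) (Fin n) R)
    (hb : ∀ i, b i ∈ N) (hb' : ∀ s ∈ N, ∃! c : Fin r → R, s = ∑ i, c i • b i)
    (he : ∀ s, ∃! c : Fin q → R, s - ∑ i, c i • e i ∈ N) :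
    ∃ B : Module.Basis (Fin r ⊕ Fin q) R (Matrix (Fin n) (Fin n) R),
      (∀ i, B (Sum.inl i) = b i) ∧ (∀ j, B (Sum.inr j) = e j) ∧
      N = Submodule.span R (Set.range b) := by
  have hN : N = Submodule.span R (Set.range b) := by
    apply le_antisymm
    · intro s hs
      obtain ⟨c, hc, -⟩ := hb' s hs
      rw [hc]
      exact Submodule.sum_mem _ fun i _ =>
        Submodule.smul_mem _ _ (Submodule.subset_span ⟨i, rfl⟩)
    · rw [Submodule.span_le]
      rintro _ ⟨i, rfl⟩
      exact hb i
  have hli : LinearIndependent R (Sum.elim b e) := by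
    rw [Fintype.linearIndependent_iff]
    intro g hg
    simp only [Fintype.sum_sum_type, Sum.elim_inl, Sum.elim_inr] at hg
    have h1 : (fun j => g (Sum.inr j)) = 0 := by
      refine (he 0).unique ?_ ?_
      · have : (0 : Matrix (Fin n) (Fin n) R) - ∑ j, g (Sum.inr j) • e j =
            ∑ i, g (Sum.inl i) • b i := by
          rw [zero_sub, neg_eq_iff_add_eq_zero, add_comm]; exact hg
        rw [this]
        exact Submodule.sum_mem _ fun i _ => Submodule.smul_mem _ _ (hb i)
      · simp
    have h2 : (fun i => g (Sum.inl i)) = 0 := by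
      refine (hb' 0 N.zero_mem).unique ?_ ?_
      · have h1' (j) : g (Sum.inr j) = 0 := congrFun h1 j
        simpa [h1'] using hg.symm
      · simp
    rintro (i | j)
    · exact congrFun h2 i
    · exact congrFun h1 j
  refine ⟨Module.Basis.mk hli ?_, ?_, ?_, hN⟩
  · intro s _
    obtain ⟨c, hc, -⟩ := he s
    have h1 : Submodule.span R (Set.range b) ≤ Submodule.span R (Set.range (Sum.elim b e)) := by
      apply Submodule.span_mono
      rintro _ ⟨i, rfl⟩
      exact ⟨Sum.inl i, rfl⟩
    rw [← sub_add_cancel s (∑ i, c i • e i)]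
    refine Submodule.add_mem _ (h1 (hN ▸ hc)) (Submodule.sum_mem _ fun j _ =>
      Submodule.smul_mem _ _ (Submodule.subset_span ⟨Sum.inr j, rfl⟩))
  · intro i; simp
  · intro j; simp

theorem basis_mem_span_inl {r q : ℕ} {M : Type*} [AddCommGroup M] [Module R M]
    (B : Module.Basis (Fin r ⊕ Fin q) R M) (s : M) :
    s ∈ Submodule.span R (Set.range fun i => B (Sum.inl i)) ↔ ∀ j, B.repr s (Sum.inr j) = 0 := by
  constructor
  · intro hs j
    induction hs using Submodule.span_induction with
    | mem x hx => obtain ⟨i, rfl⟩ := hx; simp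
    | zero => simp
    | add x y _ _ hx hy => simp [hx, hy]
    | smul c x _ hx => simp [hx]
  · intro h
    rw [← B.sum_repr s, Fintype.sum_sum_type]
    simp only [h, zero_smul, Finset.sum_const_zero, add_zero]
    exact Submodule.sum_mem _ fun i _ => Submodule.smul_mem _ _ (Submodule.subset_span ⟨i, rfl⟩)

end Algebra

/-! ### Sheaves of matrix algebras, molds and representations on schemes -/

section Schemes

variable {X Y : Scheme.{u}} {n : ℕ} {G : Type u} [Monoid G]

/-- Restriction of matrices of functions from `V` to `W ⊆ V`. -/
def resMat {V W : X.Opens} (h : W ≤ V) :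
    Matrix (Fin n) (Fin n) Γ(X, V) →+* Matrix (Fin n) (Fin n) Γ(X, W) :=
  (X.presheaf.map (homOfLE h).op).hom.mapMatrix

theorem resMat_resMat {U V W : X.Opens} (h : V ≤ U) (h' : W ≤ V)
    (s : Matrix (Fin n) (Fin n) Γ(X, U)) :
    resMat h' (resMat h s) = resMat (h'.trans h) s := by
  ext i j
  simp only [resMat, RingHom.mapMatrix_apply, Matrix.map_apply]
  rw [← CommRingCat.comp_apply, ← X.presheaf.map_comp]
  rfl

theorem resMat_self {U : X.Opens} (s : Matrix (Fin n) (Fin n) Γ(X, U)) :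
    resMat le_rfl s = s := by
  ext i j
  simp only [resMat, RingHom.mapMatrix_apply, Matrix.map_apply]
  have : (homOfLE (le_refl U)).op = 𝟙 _ := rfl
  rw [this, X.presheaf.map_id]
  rfl

theorem eq_of_locally_eq {U : X.Opens} (a b : Γ(X, U))
    (h : ∀ x ∈ U, ∃ (V : X.Opens) (hV : V ≤ U), x ∈ V ∧
      X.presheaf.map (homOfLE hV).op a = X.presheaf.map (homOfLE hV).op b) : a = b := by
  choose V hV hx he using h
  refine TopCat.Sheaf.eq_of_locally_eq' X.sheaf (fun x : U => V x.1 x.2) U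
    (fun x => homOfLE (hV x.1 x.2)) ?_ a b (fun x => he x.1 x.2)
  intro x hxU
  exact Opens.mem_iSup.mpr ⟨⟨x, hxU⟩, hx x hxU⟩

/-- A subsheaf of `𝒪_X`-algebras of `M_n(𝒪_X)`. -/
structure SubalgebraSheaf (X : Scheme.{u}) (n : ℕ) where
  sec (U : X.Opens) : Subalgebra Γ(X, U) (Matrix (Fin n) (Fin n) Γ(X, U))
  res_mem {V W : X.Opens} (h : W ≤ V) {s : Matrix (Fin n) (Fin n) Γ(X, V)}
    (hs : s ∈ sec V) : resMat h s ∈ sec W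
  mem_of_locally {U : X.Opens} {s : Matrix (Fin n) (Fin n) Γ(X, U)}
    (hs : ∀ x ∈ U, ∃ (V : X.Opens) (h : V ≤ U), x ∈ V ∧ resMat h s ∈ sec V) : s ∈ sec U

/-- `A` is a mold: the quotient sheaf `M_n(𝒪_X) / A` is locally free. Locally on `X` there are
sections `e₁, …, e_q` of `M_n(𝒪_X)` whose classes freely generate `M_n(𝒪_X) / A` over every
smaller open set. -/
def SubalgebraSheaf.IsMold (A : SubalgebraSheaf X n) : Prop :=
  ∀ x : X, ∃ (V : X.Opens) (_ : x ∈ V) (q : ℕ) (e : Fin q → Matrix (Fin n) (Fin n) Γ(X, V)),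
    ∀ (W : X.Opens) (h : W ≤ V) (s : Matrix (Fin n) (Fin n) Γ(X, W)),
      ∃! c : Fin q → Γ(X, W), s - ∑ i, c i • resMat h (e i) ∈ A.sec W

/-- `A` is a locally free `𝒪_X`-module of constant rank `r`. -/
def SubalgebraSheaf.HasRank (A : SubalgebraSheaf X n) (r : ℕ) : Prop :=
  ∀ x : X, ∃ (V : X.Opens) (_ : x ∈ V) (b : Fin r → Matrix (Fin n) (Fin n) Γ(X, V)),
    (∀ i, b i ∈ A.sec V) ∧
    ∀ (W : X.Opens) (h : W ≤ V), ∀ s ∈ A.sec W,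
      ∃! c : Fin r → Γ(X, W), s = ∑ i, c i • resMat h (b i)

/-- A unipotent mold (on a scheme over `ℤ[1/2]`): a rank `2` mold in `M_2(𝒪_X)` on which
`m = tr² - 4 det` vanishes. -/
structure SubalgebraSheaf.IsUnipotentMold (A : SubalgebraSheaf X 2) : Prop where
  isMold : A.IsMold
  hasRank : A.HasRank 2
  m_eq_zero : ∀ (U : X.Opens), ∀ s ∈ A.sec U, m s = 0

variable (X n G) in
/-- An `n`-dimensional representation of the monoid (or group) `G` on the scheme `X`. -/
abbrev Rep := G →* Matrix (Fin n) (Fin n) Γ(X, ⊤)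

/-- The representation `ρ` restricted to the open set `U`. -/
def resRep (ρ : Rep X n G) (U : X.Opens) : G →* Matrix (Fin n) (Fin n) Γ(X, U) :=
  mapRep (X.presheaf.map (homOfLE (le_top : U ≤ ⊤)).op).hom ρ

theorem mapRep_resRep (ρ : Rep X n G) {V W : X.Opens} (h : W ≤ V) :
    mapRep (X.presheaf.map (homOfLE h).op).hom (resRep ρ V) = resRep ρ W := by
  ext1 g
  exact resMat_resMat le_top h (ρ g)

theorem resMat_mem_adjoin (ρ : Rep X n G) {V W : X.Opens} (h : W ≤ V)
    {s : Matrix (Fin n) (Fin n) Γ(X, V)}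
    (hs : s ∈ Algebra.adjoin Γ(X, V) (Set.range (resRep ρ V))) :
    resMat h s ∈ Algebra.adjoin Γ(X, W) (Set.range (resRep ρ W)) := by
  have := mapMatrix_mem_adjoin (X.presheaf.map (homOfLE h).op).hom hs
  rw [← Set.range_comp] at this
  rw [← mapRep_resRep ρ h]
  exact this

/-- The subsheaf of `𝒪_X`-algebras `𝒪_X[ρ(G)] ⊆ M_n(𝒪_X)` generated by the image of `ρ`: the
sections which locally lie in the subalgebra generated by the image of `ρ`. -/
def generated (ρ : Rep X n G) : SubalgebraSheaf X n where
  sec U :=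
    { carrier := {s | ∀ x ∈ U, ∃ (V : X.Opens) (h : V ≤ U), x ∈ V ∧
        resMat h s ∈ Algebra.adjoin Γ(X, V) (Set.range (resRep ρ V))}
      mul_mem' := by
        intro a b ha hb x hx
        obtain ⟨V, hV, hxV, hs⟩ := ha x hx
        obtain ⟨W, hW, hxW, ht⟩ := hb x hx
        refine ⟨V ⊓ W, inf_le_left.trans hV, ⟨hxV, hxW⟩, ?_⟩
        rw [map_mul]
        refine Subalgebra.mul_mem _ ?_ ?_
        · rw [← resMat_resMat hV inf_le_left]; exact resMat_mem_adjoin ρ _ hs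
        · rw [← resMat_resMat hW inf_le_right]; exact resMat_mem_adjoin ρ _ ht
      add_mem' := by
        intro a b ha hb x hx
        obtain ⟨V, hV, hxV, hs⟩ := ha x hx
        obtain ⟨W, hW, hxW, ht⟩ := hb x hx
        refine ⟨V ⊓ W, inf_le_left.trans hV, ⟨hxV, hxW⟩, ?_⟩
        rw [map_add]
        refine Subalgebra.add_mem _ ?_ ?_
        · rw [← resMat_resMat hV inf_le_left]; exact resMat_mem_adjoin ρ _ hs
        · rw [← resMat_resMat hW inf_le_right]; exact resMat_mem_adjoin ρ _ ht
      algebraMap_mem' := by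
        intro c x hx
        refine ⟨U, le_rfl, hx, ?_⟩
        rw [resMat_self]
        exact Subalgebra.algebraMap_mem _ c }
  res_mem {V W} h s hs := by
    intro x hx
    obtain ⟨V', hV', hxV', hs'⟩ := hs x (h hx)
    refine ⟨V' ⊓ W, inf_le_right, ⟨hxV', hx⟩, ?_⟩
    rw [resMat_resMat, ← resMat_resMat hV' inf_le_left]
    exact resMat_mem_adjoin ρ _ hs'
  mem_of_locally {U s} hs := by
    intro x hx
    obtain ⟨V, hV, hxV, hs'⟩ := hs x hx
    obtain ⟨W, hW, hxW, hs''⟩ := hs' x hxV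
    exact ⟨W, hW.trans hV, hxW, by rwa [resMat_resMat] at hs''⟩

theorem mem_generated (ρ : Rep X n G) {U : X.Opens} {s : Matrix (Fin n) (Fin n) Γ(X, U)} :
    s ∈ (generated ρ).sec U ↔ ∀ x ∈ U, ∃ (V : X.Opens) (h : V ≤ U), x ∈ V ∧
      resMat h s ∈ Algebra.adjoin Γ(X, V) (Set.range (resRep ρ V)) := Iff.rfl

theorem adjoin_le_generated (ρ : Rep X n G) {U : X.Opens} {s : Matrix (Fin n) (Fin n) Γ(X, U)}
    (hs : s ∈ Algebra.adjoin Γ(X, U) (Set.range (resRep ρ U))) : s ∈ (generated ρ).sec U :=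
  fun _ hx => ⟨U, le_rfl, hx, by rwa [resMat_self]⟩

theorem Splits.res {ρ : Rep X n G} {V W : X.Opens} (h : W ≤ V) {r q : ℕ}
    {B : Module.Basis (Fin r ⊕ Fin q) Γ(X, V) (Matrix (Fin n) (Fin n) Γ(X, V))}
    (hB : Splits (resRep ρ V) B)
    {B' : Module.Basis (Fin r ⊕ Fin q) Γ(X, W) (Matrix (Fin n) (Fin n) Γ(X, W))}
    (hB' : ∀ i, B' i = resMat h (B i)) : Splits (resRep ρ W) B' := by
  rw [← mapRep_resRep ρ h]
  exact hB.map _ B' hB'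

theorem Splits.mem_generated_iff {ρ : Rep X n G} {W : X.Opens} {r q : ℕ}
    {B : Module.Basis (Fin r ⊕ Fin q) Γ(X, W) (Matrix (Fin n) (Fin n) Γ(X, W))}
    (hB : Splits (resRep ρ W) B) (s : Matrix (Fin n) (Fin n) Γ(X, W)) :
    s ∈ (generated ρ).sec W ↔ ∀ j, B.repr s (Sum.inr j) = 0 := by
  constructor
  · intro hs j
    refine eq_of_locally_eq _ _ fun x hx => ?_
    obtain ⟨V, hV, hxV, hs'⟩ := hs x hx
    refine ⟨V, hV, hxV, ?_⟩
    obtain ⟨B', hB'⟩ := exists_basis_map (X.presheaf.map (homOfLE hV).op).hom B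
    have hS : Splits (resRep ρ V) B' := hB.res hV hB'
    have : resMat hV s ∈ Submodule.span Γ(X, V) (Set.range fun i => B' (Sum.inl i)) := by
      rw [← hS]; exact hs'
    rw [basis_mem_span_inl] at this
    rw [map_zero]
    exact (repr_map _ B B' hB' s (Sum.inr j)).symm.trans (this j)
  · intro hs
    apply adjoin_le_generated
    rw [← basis_mem_span_inl, ← hB] at hs
    exact hs

theorem exists_splits {ρ : Rep X n G} (hM : (generated ρ).IsMold) (hR : (generated ρ).HasRank 2)
    (x : X) : ∃ (V : X.Opens) (_ : x ∈ V) (q : ℕ)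
      (B : Module.Basis (Fin 2 ⊕ Fin q) Γ(X, V) (Matrix (Fin n) (Fin n) Γ(X, V))),
      Splits (resRep ρ V) B := by
  obtain ⟨V₁, hx₁, q, e, he⟩ := hM x
  obtain ⟨V₂, hx₂, b, hb, hb'⟩ := hR x
  obtain ⟨V₃, h₃, hx₃, hb₃⟩ := hb 0 x hx₂
  obtain ⟨V₄, h₄, hx₄, hb₄⟩ := hb 1 x hx₂
  have k₁ : V₁ ⊓ V₃ ⊓ V₄ ≤ V₁ := inf_le_left.trans inf_le_left
  have k₃ : V₁ ⊓ V₃ ⊓ V₄ ≤ V₃ := inf_le_left.trans inf_le_right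
  have k₄ : V₁ ⊓ V₃ ⊓ V₄ ≤ V₄ := inf_le_right
  have k₂ : V₁ ⊓ V₃ ⊓ V₄ ≤ V₂ := k₃.trans h₃
  obtain ⟨B, hB₁, hB₂, hB₃⟩ := exists_basis_of_coords
    (Subalgebra.toSubmodule ((generated ρ).sec (V₁ ⊓ V₃ ⊓ V₄)))
    (fun i => resMat k₂ (b i)) (fun j => resMat k₁ (e j))
    (fun i => (generated ρ).res_mem k₂ (hb i)) (fun s hs => hb' _ k₂ s hs) (fun s => he _ k₁ s)
  refine ⟨V₁ ⊓ V₃ ⊓ V₄, ⟨⟨hx₁, hx₃⟩, hx₄⟩, q, B, ?_⟩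
  have hfun : (fun i => B (Sum.inl i)) = fun i => resMat k₂ (b i) := funext hB₁
  unfold Splits
  apply le_antisymm
  · rw [hfun, ← hB₃]
    intro s hs
    exact adjoin_le_generated ρ hs
  · rw [Submodule.span_le]
    rintro _ ⟨i, rfl⟩
    beta_reduce
    rw [hB₁]
    change resMat k₂ (b i) ∈ Algebra.adjoin _ _
    have hi : i = 0 ∨ i = 1 := by omega
    rcases hi with rfl | rfl
    · rw [← resMat_resMat h₃ k₃]; exact resMat_mem_adjoin ρ _ hb₃
    · rw [← resMat_resMat h₄ k₄]; exact resMat_mem_adjoin ρ _ hb₄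

theorem isMold_of_splits {ρ : Rep X n G} {r : ℕ} (h : ∀ x : X, ∃ (V : X.Opens) (_ : x ∈ V) (q : ℕ)
      (B : Module.Basis (Fin r ⊕ Fin q) Γ(X, V) (Matrix (Fin n) (Fin n) Γ(X, V))),
      Splits (resRep ρ V) B) : (generated ρ).IsMold ∧ (generated ρ).HasRank r := by
  constructor
  · intro x
    obtain ⟨V, hx, q, B, hB⟩ := h x
    refine ⟨V, hx, q, fun j => B (Sum.inr j), fun W hW s => ?_⟩
    obtain ⟨B', hB'⟩ := exists_basis_map (X.presheaf.map (homOfLE hW).op).hom B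
    have hS : Splits (resRep ρ W) B' := hB.res hW hB'
    have key (c : Fin q → Γ(X, W)) : s - ∑ i, c i • resMat hW (B (Sum.inr i)) ∈
        (generated ρ).sec W ↔ ∀ j, B'.repr s (Sum.inr j) = c j := by
      rw [hS.mem_generated_iff]
      refine forall_congr' fun j => ?_
      have h1 (i : Fin q) : resMat hW (B (Sum.inr i)) = B' (Sum.inr i) := (hB' _).symm
      simp [h1, sub_eq_zero, Finsupp.single_apply]
    refine ⟨fun j => B'.repr s (Sum.inr j), (key _).2 fun _ => rfl, fun c hc => ?_⟩
    exact funext fun j => ((key c).1 hc j).symm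
  · intro x
    obtain ⟨V, hx, q, B, hB⟩ := h x
    refine ⟨V, hx, fun i => B (Sum.inl i), fun i => ?_, fun W hW s hs => ?_⟩
    · rw [hB.mem_generated_iff]; intro j; simp
    obtain ⟨B', hB'⟩ := exists_basis_map (X.presheaf.map (homOfLE hW).op).hom B
    have hS : Splits (resRep ρ W) B' := hB.res hW hB'
    rw [hS.mem_generated_iff] at hs
    have h1 (i : Fin r) : resMat hW (B (Sum.inl i)) = B' (Sum.inl i) := (hB' _).symm
    simp only [h1]
    refine ⟨fun i => B'.repr s (Sum.inl i), ?_, fun c hc => ?_⟩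
    · beta_reduce
      conv_lhs => rw [← B'.sum_repr s, Fintype.sum_sum_type]
      simp [hs]
    · funext i
      rw [hc]
      simp [Finsupp.single_apply]

/-- The pullback `f^* ρ` of a representation along a morphism `f : Y ⟶ X`. -/
def pullRep (f : Y ⟶ X) (ρ : Rep X n G) : Rep Y n G := mapRep f.appTop.hom ρ

theorem resRep_pullRep (f : Y ⟶ X) (ρ : Rep X n G) (V : X.Opens) :
    resRep (pullRep f ρ) (f ⁻¹ᵁ V) = mapRep (f.app V).hom (resRep ρ V) := by
  ext g i j
  have := CommRingCat.comp_apply (f.app ⊤) (Y.presheaf.map (homOfLE (le_top : f ⁻¹ᵁ V ≤ ⊤)).op)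
    (ρ g i j)
  have h2 := CommRingCat.comp_apply (X.presheaf.map (homOfLE (le_top : V ≤ ⊤)).op) (f.app V)
    (ρ g i j)
  refine Eq.trans ?_ h2
  rw [f.naturality]
  rfl

/-- A representation with unipotent mold. -/
def HasUnipotentMold (ρ : Rep X 2 G) : Prop := (generated ρ).IsUnipotentMold

theorem HasUnipotentMold.pullRep {ρ : Rep X 2 G} (hρ : HasUnipotentMold ρ) (f : Y ⟶ X) :
    HasUnipotentMold (pullRep f ρ) := by
  have key (y : Y) : ∃ (V : Y.Opens) (_ : y ∈ V) (q : ℕ)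
      (B : Module.Basis (Fin 2 ⊕ Fin q) Γ(Y, V) (Matrix (Fin 2) (Fin 2) Γ(Y, V))),
      Splits (resRep (UnipotentMold.pullRep f ρ) V) B ∧
        m (B (Sum.inl 0)) = 0 ∧ m (B (Sum.inl 1)) = 0 ∧
        m (B (Sum.inl 0) + B (Sum.inl 1)) = 0 := by
    obtain ⟨V, hV, q, B, hB⟩ := exists_splits hρ.isMold hρ.hasRank (f y)
    obtain ⟨B', hB'⟩ := exists_basis_map (f.app V).hom B
    have h0 (i : Fin 2) : B (Sum.inl i) ∈ (generated ρ).sec V := by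
      rw [hB.mem_generated_iff]; intro j; simp
    refine ⟨f ⁻¹ᵁ V, hV, q, B', ?_, ?_, ?_, ?_⟩
    · rw [resRep_pullRep]; exact hB.map _ B' hB'
    · rw [hB', m_map, hρ.m_eq_zero _ _ (h0 0), map_zero]
    · rw [hB', m_map, hρ.m_eq_zero _ _ (h0 1), map_zero]
    · rw [hB', hB', ← map_add, m_map, hρ.m_eq_zero _ _ (Subalgebra.add_mem _ (h0 0) (h0 1)),
        map_zero]
  obtain ⟨hM, hR⟩ := isMold_of_splits (ρ := UnipotentMold.pullRep f ρ) (r := 2) fun y => by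
    obtain ⟨V, hV, q, B, hB, -⟩ := key y
    exact ⟨V, hV, q, B, hB⟩
  refine ⟨hM, hR, fun U s hs => ?_⟩
  refine eq_of_locally_eq _ _ fun y hy => ?_
  obtain ⟨V, hV, q, B, hB, m0, m1, m2⟩ := key y
  refine ⟨U ⊓ V, inf_le_left, ⟨hy, hV⟩, ?_⟩
  rw [map_zero]
  refine (m_map (Y.presheaf.map (homOfLE (inf_le_left : U ⊓ V ≤ U)).op).hom s).symm.trans ?_
  have hs' := (generated (UnipotentMold.pullRep f ρ)).res_mem (inf_le_left : U ⊓ V ≤ U) hs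
  obtain ⟨B', hB'⟩ := exists_basis_map
    (Y.presheaf.map (homOfLE (inf_le_right : U ⊓ V ≤ V)).op).hom B
  have hS := hB.res (inf_le_right : U ⊓ V ≤ V) hB'
  rw [hS.mem_generated_iff] at hs'
  change m (resMat inf_le_left s) = 0
  rw [← B'.sum_repr (resMat inf_le_left s), Fintype.sum_sum_type, Fin.sum_univ_two]
  simp only [hs', zero_smul, Finset.sum_const_zero, add_zero]
  apply m_comb
  · rw [hB', m_map, m0, map_zero]
  · rw [hB', m_map, m1, map_zero]
  · rw [hB', hB', ← map_add, m_map, m2, map_zero]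

/-- Two representations on `X` are equivalent if they are carried to each other by an automorphism
of the `Γ(X, 𝒪_X)`-algebra `M_n(Γ(X, 𝒪_X))`. -/
def Equivalent (ρ₁ ρ₂ : Rep X n G) : Prop :=
  ∃ σ : Matrix (Fin n) (Fin n) Γ(X, ⊤) ≃ₐ[Γ(X, ⊤)] Matrix (Fin n) (Fin n) Γ(X, ⊤),
    ∀ g, σ (ρ₁ g) = ρ₂ g

theorem Equivalent.pullRep {ρ₁ ρ₂ : Rep X n G} (h : Equivalent ρ₁ ρ₂) (f : Y ⟶ X) :
    Equivalent (pullRep f ρ₁) (pullRep f ρ₂) := by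
  obtain ⟨σ, hσ⟩ := h
  obtain ⟨τ, hτ⟩ := exists_algEquiv_map f.appTop.hom σ
  refine ⟨τ, fun g => ?_⟩
  change τ (f.appTop.hom.mapMatrix (ρ₁ g)) = f.appTop.hom.mapMatrix (ρ₂ g)
  rw [hτ, hσ]

variable (X G) in
/-- The `2`-dimensional representations of `G` on `X` with unipotent mold. -/
abbrev UnipotentRep := {ρ : Rep X 2 G // HasUnipotentMold ρ}

variable (X G) in
/-- Equivalence of representations with unipotent mold. -/
instance unipotentRepSetoid : Setoid (UnipotentRep X G) where
  r ρ₁ ρ₂ := Equivalent ρ₁.1 ρ₂.1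
  iseqv :=
    { refl := fun _ => ⟨AlgEquiv.refl, fun _ => rfl⟩
      symm := fun ⟨σ, h⟩ => ⟨σ.symm, fun g => by rw [← h g, AlgEquiv.symm_apply_apply]⟩
      trans := fun ⟨σ, h⟩ ⟨τ, k⟩ => ⟨σ.trans τ, fun g => by
        rw [AlgEquiv.trans_apply, h g, k g]⟩ }

variable (G) in
/-- The functor `X ↦ {representations of G on X with unipotent mold} / ∼`. -/
def unipotentClasses : Scheme.{u}ᵒᵖ ⥤ Type u where
  obj X := Quotient (unipotentRepSetoid X.unop G)
  map f := TypeCat.ofHom (Quotient.map (fun ρ => ⟨pullRep f.unop ρ.1, ρ.2.pullRep f.unop⟩)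
    fun _ _ h => h.pullRep f.unop)
  map_id X := by
    ext x
    induction x using Quotient.inductionOn with
    | h ρ =>
      apply congrArg (Quotient.mk _)
      apply Subtype.ext
      ext g i j
      simp [pullRep, mapRep]
  map_comp f g := by
    ext x
    induction x using Quotient.inductionOn with
    | h ρ =>
      apply congrArg (Quotient.mk _)
      apply Subtype.ext
      ext g i j
      simp only [pullRep, mapRep, Scheme.Hom.appTop, unop_comp, Scheme.Hom.comp_app,
        Scheme.Hom.preimage_top]
      rfl

end Schemes

/-! ### The sheafified functor on schemes over `ℤ[1/2]` -/

/-- The ring `ℤ[1/2]`. -/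
def ZHalf : Type u := ULift.{u} (Localization.Away (2 : ℤ))

instance : CommRing ZHalf.{u} := inferInstanceAs (CommRing (ULift.{u} (Localization.Away (2 : ℤ))))

/-- `Spec ℤ[1/2]`. -/
abbrev SpecZHalf : Scheme.{u} := Spec (CommRingCat.of ZHalf.{u})

variable (G : Type u) [Monoid G]

/-- The presheaf `X ↦ {representations of G on X with unipotent mold} / ∼` on the category of
schemes over `ℤ[1/2]`. -/
def preEqU : (Over SpecZHalf.{u})ᵒᵖ ⥤ Type (u + 1) :=
  (Over.forget SpecZHalf.{u}).op ⋙ unipotentClasses G ⋙ uliftFunctor.{u + 1, u}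

/-- The sheafification of `preEqU G` with respect to the Zariski topology. -/
def EqU : (Over SpecZHalf.{u})ᵒᵖ ⥤ Type (u + 1) :=
  sheafify (Scheme.zariskiTopology.{u}.over SpecZHalf.{u}) (preEqU G)

/-! ### Degree one representations and derivations -/

/-- The relations `χ(1) = 1` and `χ(g h) = χ(g) χ(h)`. -/
def coordIdeal : Ideal (MvPolynomial G ZHalf.{u}) :=
  Ideal.span ({MvPolynomial.X 1 - 1} ∪ Set.range fun p : G × G =>
    MvPolynomial.X (p.1 * p.2) - MvPolynomial.X p.1 * MvPolynomial.X p.2)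

/-- The coordinate ring of `Rep₁(G)[1/2]`: the `ℤ[1/2]`-algebra generated by symbols `χ(g)`,
subject to the relations `χ(1) = 1` and `χ(g h) = χ(g) χ(h)`. -/
def CoordRing : Type u :=
  MvPolynomial G ZHalf.{u} ⧸ coordIdeal G

instance : CommRing (CoordRing G) :=
  inferInstanceAs (CommRing (MvPolynomial G ZHalf.{u} ⧸ coordIdeal G))

instance : Algebra ZHalf.{u} (CoordRing G) :=
  inferInstanceAs (Algebra ZHalf.{u} (MvPolynomial G ZHalf.{u} ⧸ coordIdeal G))

/-- The universal character of `G`. -/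
def univChar : G →* CoordRing G where
  toFun g := Ideal.Quotient.mk (coordIdeal G) (MvPolynomial.X g)
  map_one' := by
    refine ((Ideal.Quotient.eq (I := coordIdeal G)).2 ?_).trans
      (map_one (Ideal.Quotient.mk (coordIdeal G)))
    exact Ideal.subset_span (Or.inl rfl)
  map_mul' g h := by
    refine ((Ideal.Quotient.eq (I := coordIdeal G)).2 ?_).trans
      (map_mul (Ideal.Quotient.mk (coordIdeal G)) _ _)
    exact Ideal.subset_span (Or.inr ⟨(g, h), rfl⟩)

/-- `Spec (CoordRing G)` represents degree one representations over `ℤ[1/2]`. -/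
theorem univChar_universal {B : Type*} [CommRing B] [Algebra ZHalf.{u} B] (r : G →* B) :
    ∃! φ : CoordRing G →ₐ[ZHalf.{u}] B, ∀ g, φ (univChar G g) = r g := by
  refine ⟨Ideal.Quotient.liftₐ (coordIdeal G) (MvPolynomial.aeval r) ?_, ?_, ?_⟩
  · intro a ha
    change a ∈ RingHom.ker (MvPolynomial.aeval r)
    revert a
    change Ideal.span _ ≤ _
    rw [Ideal.span_le]
    rintro _ (rfl | ⟨p, rfl⟩)
    · simp [RingHom.mem_ker]
    · simp [RingHom.mem_ker]
  · intro g
    exact MvPolynomial.aeval_X r g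
  · intro φ hφ
    apply Ideal.Quotient.algHom_ext
    apply MvPolynomial.algHom_ext
    intro g
    exact (hφ g).trans (MvPolynomial.aeval_X r g).symm

/-- `a : G → M` is a derivation with respect to the universal character. -/
def IsDerivation {M : Type*} [AddCommGroup M] [Module (CoordRing G) M] (a : G → M) : Prop :=
  ∀ g h, a (g * h) = univChar G g • a h + univChar G h • a g

/-- The relations `d(g h) = χ(g) dh + χ(h) dg`. -/
def derRelations : Submodule (CoordRing G) (G →₀ CoordRing G) :=
  Submodule.span (CoordRing G) (Set.range fun p : G × G =>
    univChar G p.1 • Finsupp.single p.2 (1 : CoordRing G) +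
      univChar G p.2 • Finsupp.single p.1 (1 : CoordRing G) -
      Finsupp.single (p.1 * p.2) (1 : CoordRing G))

/-- The universal module of derivations `Ω_G`: generated by symbols `dg`, subject to the
relations `d(g h) = χ(g) dh + χ(h) dg`. -/
def Omega : Type u := (G →₀ CoordRing G) ⧸ derRelations G

instance : AddCommGroup (Omega G) :=
  inferInstanceAs (AddCommGroup ((G →₀ CoordRing G) ⧸ derRelations G))

instance : Module (CoordRing G) (Omega G) :=
  inferInstanceAs (Module (CoordRing G) ((G →₀ CoordRing G) ⧸ derRelations G))

/-- The universal derivation. -/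
def univDer (g : G) : Omega G := (derRelations G).mkQ (Finsupp.single g 1)

theorem isDerivation_univDer : IsDerivation G (univDer G) := by
  intro g h
  rw [eq_comm, ← sub_eq_zero]
  exact (Submodule.Quotient.mk_eq_zero (derRelations G)).2 (Submodule.subset_span ⟨(g, h), rfl⟩)

/-- `Ω_G` represents the functor of derivations. -/
theorem univDer_universal {M : Type*} [AddCommGroup M] [Module (CoordRing G) M] (a : G → M)
    (ha : IsDerivation G a) :
    ∃! f : Omega G →ₗ[CoordRing G] M, ∀ g, f (univDer G g) = a g := by
  have hle : derRelations G ≤ LinearMap.ker (Finsupp.linearCombination (CoordRing G) a) := by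
    refine Submodule.span_le.2 ?_
    rintro _ ⟨p, rfl⟩
    simp [ha p.1 p.2]
  have hlift (g : G) : (derRelations G).liftQ (Finsupp.linearCombination _ a) hle (univDer G g) =
      a g := (Submodule.liftQ_apply (derRelations G) _ _).trans (by simp)
  refine ⟨(derRelations G).liftQ (Finsupp.linearCombination _ a) hle, hlift, ?_⟩
  intro f hf
  apply Submodule.linearMap_qext
  apply Finsupp.lhom_ext'
  intro g
  apply LinearMap.ext_ring
  exact (hf g).trans (hlift g).symm

/-! ### The moduli scheme `Proj S(Ω_G)` -/

section Symmetric

variable (R M : Type*) [CommRing R] [AddCommGroup M] [Module R M]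

/-- The degree `i` part of the symmetric algebra. -/
def symGrading (i : ℕ) : Submodule R (SymmetricAlgebra R M) :=
  LinearMap.range (SymmetricAlgebra.ι R M) ^ i

instance symGrading_gradedMonoid : SetLike.GradedMonoid (symGrading R M) where
  one_mem := by
    change (1 : SymmetricAlgebra R M) ∈ LinearMap.range (SymmetricAlgebra.ι R M) ^ 0
    rw [pow_zero]
    exact Submodule.one_le.mp le_rfl
  mul_mem i j x y hx hy := by
    change _ ∈ LinearMap.range (SymmetricAlgebra.ι R M) ^ (i + j)
    rw [pow_add]
    exact Submodule.mul_mem_mul hx hy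

/-- The inclusion of `M` as the degree one part of the symmetric algebra. -/
def symGradingι : M →ₗ[R] DirectSum ℕ fun i => symGrading R M i :=
  DirectSum.lof R ℕ (fun i => symGrading R M i) 1 ∘ₗ
    (SymmetricAlgebra.ι R M).codRestrict (symGrading R M 1) fun x => by
      simpa only [symGrading, pow_one] using LinearMap.mem_range_self _ x

/-- The symmetric algebra is graded by degree. -/
instance symGradedAlgebra : GradedAlgebra (symGrading R M) :=
  GradedAlgebra.ofAlgHom _ (SymmetricAlgebra.lift (symGradingι R M))
    (by
      ext x
      simp [symGradingι, DirectSum.lof_eq_of, DirectSum.coeAlgHom_of])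
    fun i x => by
      obtain ⟨x, hx⟩ := x
      dsimp only [Subtype.coe_mk, DirectSum.lof_eq_of]
      unfold symGrading at hx
      induction hx using Submodule.pow_induction_on_left' with
      | algebraMap r =>
        rw [AlgHom.commutes, DirectSum.algebraMap_apply]; rfl
      | add x y i hx hy ihx ihy =>
        rw [map_add, ihx, ihy, ← map_add]
        rfl
      | mem_mul m hm i x hx ih =>
        obtain ⟨_, rfl⟩ := hm
        rw [map_mul, ih, SymmetricAlgebra.lift_ι_apply]
        exact (DirectSum.of_mul_of _ _).trans
          (DirectSum.of_eq_of_gradedMonoid_eq (Sigma.subtype_ext (add_comm _ _) rfl))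

end Symmetric

/-- `Proj S(M)`, where `S(M)` is the symmetric algebra of the `R`-module `M`. -/
def ProjSym (R M : Type u) [CommRing R] [AddCommGroup M] [Module R M] : Scheme.{u} :=
  Proj (symGrading R M)

/-- The structure morphism `Proj S(M) ⟶ Spec R`. -/
def ProjSym.toSpec (R M : Type u) [CommRing R] [AddCommGroup M] [Module R M] :
    ProjSym R M ⟶ Spec (CommRingCat.of R) :=
  Proj.toSpecZero (symGrading R M) ≫
    Spec.map (CommRingCat.ofHom (algebraMap R (symGrading R M 0)))

/-- `Ch₂(G)_u = Proj S(Ω_G)`, as a scheme over `ℤ[1/2]` via `Rep₁(G)[1/2] = Spec (CoordRing G)`. -/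
def Ch : Over SpecZHalf.{u} :=
  Over.mk (ProjSym.toSpec (CoordRing G) (Omega G) ≫
    Spec.map (CommRingCat.ofHom (algebraMap ZHalf.{u} (CoordRing G))))

end UnipotentMold

end

/-!
The sheafification of `X ↦ {representations with unipotent mold} / ∼` and the sheaf of morphisms
to `Proj S(Ω_G)` are compared through normal forms: triples consisting of a character `χ` of `G`,
a derivation `d` along `χ` and an element `g` of `G` with `d g = 1` (`NormalForm`). Such a triple
gives the representation `h ↦ !![χ h, d h; 0, χ h]`, whose mold is unipotent, and it is the same
thing as a morphism to the chart of `Proj S(Ω_G)` on which `dg` is invertible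
(`NormalForm.exists_normalFormOfHom`, `normalFormOfHom_injective`).

Both constructions identify exactly the same normal forms, namely the proportional ones, which
have the same character and derivations that differ by a unit. For representations
(`NormalForm.exists_algEquiv_iff`) the character is recovered from the trace, which every algebra
automorphism preserves, and then the image of `E₁₂` gives the unit; for morphisms
(`chartMor_eq_iff`) the unit is the ratio `dg / dg'` on the intersection of two charts.

Both constructions are also locally surjective. The charts cover `Proj S(Ω_G)`
(`exists_chartMor_eq`). For a representation `ρ` with unipotent mold, the algebra `A` generated by
`ρ` is locally free of rank two, hence commutative (`Splits.commute`), and at every point some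
`ρ g` is not scalar, hence has an invertible entry off the diagonal (`Splits.exists_notMem`). The
matrix `N = ρ g - χ g` with `χ = tr / 2` is traceless of determinant zero, so it is conjugate to
`E₁₂`, and commutativity forces every `ρ h - χ h` to be a multiple of `N`
(`exists_normalForm`).

The presheaf of pairs of a class of representations and a morphism which come from a common normal
form therefore maps locally bijectively to both sides, so that all three have the same
sheafification (`nonempty_representableBy_sheafify`). No map to `Proj` has to be glued.
Separatedness is that of `Proj` over its ring of degree zero, and if `G` is finitely generated,
then so are the algebra `CoordRing G` and the module `Ω_G`.
-/

open CategoryTheory AlgebraicGeometry TopologicalSpace Opposite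

universe v

noncomputable section

namespace UnipotentMold

/-! ### Automorphisms of the algebra of `2 × 2` matrices -/

section Matrices

variable {R : Type*} [CommRing R]

/-- Conjugation `s ↦ P s P⁻¹` by an invertible matrix. -/
def conjAlgEquiv (P : (Matrix (Fin 2) (Fin 2) R)ˣ) :
    Matrix (Fin 2) (Fin 2) R ≃ₐ[R] Matrix (Fin 2) (Fin 2) R :=
  MulSemiringAction.toAlgEquiv R _ (ConjAct.toConjAct P)

theorem conjAlgEquiv_eq_of_mul_eq (P : (Matrix (Fin 2) (Fin 2) R)ˣ) {s t : Matrix (Fin 2) (Fin 2) R}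
    (h : (P : Matrix (Fin 2) (Fin 2) R) * s = t * P) : conjAlgEquiv P s = t := by
  change ConjAct.toConjAct P • s = t
  rw [ConjAct.units_smul_def]
  simp [h, mul_assoc]

theorem trace_mulLeft (s : Matrix (Fin 2) (Fin 2) R) :
    LinearMap.trace R _ (LinearMap.mulLeft R s) = 2 * s.trace := by
  rw [LinearMap.trace_eq_matrix_trace R (Matrix.stdBasis R (Fin 2) (Fin 2))]
  simp only [Matrix.trace, Matrix.diag, LinearMap.toMatrix_apply, Fintype.sum_prod_type,
    Fin.sum_univ_two, Matrix.stdBasis_eq_single, LinearMap.mulLeft_apply]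
  simp [Matrix.stdBasis, Matrix.mul_apply, Matrix.single_apply]
  ring

/-- Every algebra automorphism preserves the trace: up to the factor `2`, the trace of a matrix is
the trace of left multiplication by it. -/
theorem trace_algEquiv (h2 : IsUnit (2 : R))
    (σ : Matrix (Fin 2) (Fin 2) R ≃ₐ[R] Matrix (Fin 2) (Fin 2) R) (s : Matrix (Fin 2) (Fin 2) R) :
    (σ s).trace = s.trace := by
  rw [← h2.mul_right_inj, ← trace_mulLeft, ← trace_mulLeft,
    ← LinearMap.trace_conj' (LinearMap.mulLeft R s) σ.toLinearEquiv]
  congr 1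
  ext1 t
  simp [LinearEquiv.conj_apply]

end Matrices

/-! ### Triangular normal forms -/

/-- A character `char` of `G` and a derivation `der` along it which takes the value `1` at the
element `base`. -/
@[ext]
structure NormalForm (G R : Type*) [Monoid G] [CommRing R] where
  char : G →* R
  der : G → R
  base : G
  der_mul (g h : G) : der (g * h) = char g * der h + char h * der g
  der_base : der base = 1

namespace NormalForm

variable {G R S : Type*} [Monoid G] [CommRing R] [CommRing S]

/-- The unipotent representation `g ↦ !![χ g, d g; 0, χ g]`. -/
def rep (a : NormalForm G R) : G →* Matrix (Fin 2) (Fin 2) R where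
  toFun g := !![a.char g, a.der g; 0, a.char g]
  map_one' := by
    have h : a.der 1 = 0 := by simpa using a.der_mul 1 1
    rw [h, map_one, Matrix.one_fin_two]
  map_mul' g h := by
    rw [map_mul, a.der_mul, Matrix.mul_fin_two]
    congr! 1
    simp [mul_comm]

theorem rep_apply (a : NormalForm G R) (g : G) :
    a.rep g = !![a.char g, a.der g; 0, a.char g] := rfl

/-- The image of a normal form under a ring homomorphism. -/
def map (φ : R →+* S) (a : NormalForm G R) : NormalForm G S where
  char := φ.toMonoidHom.comp a.char
  der g := φ (a.der g)
  base := a.base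
  der_mul g h := by simp [a.der_mul]
  der_base := by simp [a.der_base]

theorem mapRep_rep (φ : R →+* S) (a : NormalForm G R) : mapRep φ a.rep = (a.map φ).rep := by
  ext g i j
  fin_cases i <;> fin_cases j <;> simp [mapRep, rep_apply, map]

/-- Two normal forms are proportional if they have the same character and if their derivations
agree up to a unit; since both derivations take the value `1`, the unit is `b.der a.base`. -/
def Proportional (a b : NormalForm G R) : Prop :=
  a.char = b.char ∧ ∀ g, b.der g = b.der a.base * a.der g

theorem Proportional.isUnit {a b : NormalForm G R} (h : a.Proportional b) :
    IsUnit (b.der a.base) :=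
  .of_mul_eq_one _ ((h.2 b.base).symm.trans b.der_base)

theorem exists_algEquiv_iff (h2 : IsUnit (2 : R)) (a b : NormalForm G R) :
    (∃ σ : Matrix (Fin 2) (Fin 2) R ≃ₐ[R] Matrix (Fin 2) (Fin 2) R, ∀ g, σ (a.rep g) = b.rep g) ↔
      a.Proportional b := by
  have key (c : NormalForm G R) (g : G) : c.rep g = c.char g • 1 + c.der g • !![0, 1; 0, 0] := by
    ext i j
    fin_cases i <;> fin_cases j <;> simp [rep_apply]
  constructor
  · rintro ⟨σ, hσ⟩
    have hchar : a.char = b.char := by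
      ext g
      have := trace_algEquiv h2 σ (a.rep g)
      rw [hσ, rep_apply, rep_apply, Matrix.trace_fin_two_of, Matrix.trace_fin_two_of,
        ← two_mul, ← two_mul, h2.mul_right_inj] at this
      exact this.symm
    have h1 (g : G) : a.der g • σ !![0, 1; 0, 0] = b.der g • !![0, 1; 0, 0] := by
      have := hσ g
      rw [key, key, map_add, map_smul, map_smul, map_one, hchar] at this
      exact add_left_cancel this
    refine ⟨hchar, fun g => ?_⟩
    have h3 := h1 a.base
    rw [a.der_base, one_smul] at h3
    have h4 := congrFun (congrFun (h1 g) 0) 1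
    rw [h3] at h4
    simpa [mul_comm] using h4.symm
  · intro h
    obtain ⟨u, hu⟩ := h.isUnit
    have hdet : IsUnit (!![(u : R), 0; 0, 1] : Matrix (Fin 2) (Fin 2) R) := by
      rw [Matrix.isUnit_iff_isUnit_det]
      simp
    obtain ⟨P, hP⟩ := hdet
    refine ⟨conjAlgEquiv P, fun g => conjAlgEquiv_eq_of_mul_eq P ?_⟩
    rw [hP, rep_apply, rep_apply, Matrix.mul_fin_two, Matrix.mul_fin_two, h.1, h.2 g, ← hu]
    simp [mul_comm]

/-- The matrices `1, E₁₂, E₂₁, E₁₁` form a basis of the algebra of `2 × 2` matrices. -/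
theorem exists_basis (R : Type*) [CommRing R] :
    ∃ B : Module.Basis (Fin 2 ⊕ Fin 2) R (Matrix (Fin 2) (Fin 2) R),
      B (Sum.inl 0) = 1 ∧ B (Sum.inl 1) = !![0, 1; 0, 0] := by
  let b : Fin 2 → Matrix (Fin 2) (Fin 2) R := ![1, !![0, 1; 0, 0]]
  let e : Fin 2 → Matrix (Fin 2) (Fin 2) R := ![!![0, 0; 1, 0], !![1, 0; 0, 0]]
  have hli : LinearIndependent R (Sum.elim b e) := by
    rw [Fintype.linearIndependent_iff]
    intro g hg
    simp only [Fintype.sum_sum_type, Sum.elim_inl, Sum.elim_inr, Fin.sum_univ_two, b, e] at hg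
    have h00 := congrFun (congrFun hg 0) 0
    have h01 := congrFun (congrFun hg 0) 1
    have h10 := congrFun (congrFun hg 1) 0
    have h11 := congrFun (congrFun hg 1) 1
    simp at h00 h01 h10 h11
    rintro (i | i) <;> fin_cases i <;> simp_all
  suffices hsp : ⊤ ≤ Submodule.span R (Set.range (Sum.elim b e)) from
    ⟨Module.Basis.mk hli hsp, by simp [b], by simp [b]⟩
  intro s _
  have hs : s = s 1 1 • b 0 + s 0 1 • b 1 + (s 1 0 • e 0 + (s 0 0 - s 1 1) • e 1) := by
    ext i j
    fin_cases i <;> fin_cases j <;> simp [b, e]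
  rw [hs]
  have hb (i) : b i ∈ Submodule.span R (Set.range (Sum.elim b e)) :=
    Submodule.subset_span ⟨Sum.inl i, rfl⟩
  have he (i) : e i ∈ Submodule.span R (Set.range (Sum.elim b e)) :=
    Submodule.subset_span ⟨Sum.inr i, rfl⟩
  exact add_mem (add_mem (Submodule.smul_mem _ _ (hb 0)) (Submodule.smul_mem _ _ (hb 1)))
    (add_mem (Submodule.smul_mem _ _ (he 0)) (Submodule.smul_mem _ _ (he 1)))

theorem splits_rep (a : NormalForm G R) {q : ℕ}
    (B : Module.Basis (Fin 2 ⊕ Fin q) R (Matrix (Fin 2) (Fin 2) R))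
    (h0 : B (Sum.inl 0) = 1) (h1 : B (Sum.inl 1) = !![0, 1; 0, 0]) : Splits a.rep B := by
  have hrange : (Set.range fun i => B (Sum.inl i)) = {1, !![0, 1; 0, 0]} := by
    ext s
    simp [Fin.exists_fin_two, h0, h1, eq_comm]
  unfold Splits
  rw [hrange]
  apply le_antisymm
  · intro s hs
    change s ∈ Algebra.adjoin _ _ at hs
    rw [Submodule.mem_span_pair]
    induction hs using Algebra.adjoin_induction with
    | mem x hx =>
      obtain ⟨g, rfl⟩ := hx
      refine ⟨a.char g, a.der g, ?_⟩
      ext i j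
      fin_cases i <;> fin_cases j <;> simp [rep_apply]
    | algebraMap r => exact ⟨r, 0, by simp [Algebra.algebraMap_eq_smul_one]⟩
    | add x y _ _ hx hy =>
      obtain ⟨r, t, rfl⟩ := hx
      obtain ⟨r', t', rfl⟩ := hy
      exact ⟨r + r', t + t', by module⟩
    | mul x y _ _ hx hy =>
      obtain ⟨r, t, rfl⟩ := hx
      obtain ⟨r', t', rfl⟩ := hy
      refine ⟨r * r', r * t' + t * r', ?_⟩
      ext i j
      fin_cases i <;> fin_cases j <;> simp [Matrix.mul_apply, Fin.sum_univ_two]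
  · rw [Submodule.span_le]
    have hN : (!![0, 1; 0, 0] : Matrix (Fin 2) (Fin 2) R) =
        a.rep a.base - a.char a.base • 1 := by
      ext i j
      fin_cases i <;> fin_cases j <;> simp [rep_apply, a.der_base]
    rintro s (rfl | rfl)
    · exact Subalgebra.one_mem _
    · rw [hN]
      exact Subalgebra.sub_mem _ (Algebra.subset_adjoin ⟨_, rfl⟩)
        (Subalgebra.smul_mem _ (Subalgebra.one_mem _) _)

end NormalForm

/-! ### Local structure of representations with unipotent mold -/

section LocalStructure

variable {G R : Type*} [Monoid G] [CommRing R] {ρ : G →* Matrix (Fin 2) (Fin 2) R} {q : ℕ}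
  {B : Module.Basis (Fin 2 ⊕ Fin q) R (Matrix (Fin 2) (Fin 2) R)}

theorem Splits.exists_eq (hB : Splits ρ B) {s : Matrix (Fin 2) (Fin 2) R}
    (hs : s ∈ Algebra.adjoin R (Set.range ρ)) :
    ∃ x y : R, s = x • B (Sum.inl 0) + y • B (Sum.inl 1) := by
  have hs' : s ∈ Submodule.span R (Set.range fun i => B (Sum.inl i)) := by
    rw [← hB]; exact hs
  obtain ⟨c, hc⟩ := (Submodule.mem_span_range_iff_exists_fun R).1 hs'
  exact ⟨c 0, c 1, by rw [← hc, Fin.sum_univ_two]⟩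

theorem Splits.basis_mem (hB : Splits ρ B) (i : Fin 2) :
    B (Sum.inl i) ∈ Algebra.adjoin R (Set.range ρ) := by
  have : B (Sum.inl i) ∈ Submodule.span R (Set.range fun i => B (Sum.inl i)) :=
    Submodule.subset_span ⟨i, rfl⟩
  rwa [← hB] at this

/-- An algebra of rank two is commutative: if `1 = x b₀ + y b₁`, then the commutator of `b₀` and
`b₁` is killed by `x` and by `y`, and `x` and `y` generate the unit ideal. -/
theorem Splits.commute (hB : Splits ρ B) {s t : Matrix (Fin 2) (Fin 2) R}
    (hs : s ∈ Algebra.adjoin R (Set.range ρ)) (ht : t ∈ Algebra.adjoin R (Set.range ρ)) :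
    s * t = t * s := by
  obtain ⟨x, y, h1⟩ := hB.exists_eq (Subalgebra.one_mem _)
  set b₀ := B (Sum.inl 0)
  set b₁ := B (Sum.inl 1)
  have hunit : x * b₀ 0 0 + y * b₁ 0 0 = 1 := by
    simpa using (congrFun (congrFun h1 0) 0).symm
  have hx : x • (b₀ * b₁ - b₁ * b₀) = 0 := by
    have h : x • (b₀ * b₁ - b₁ * b₀) =
        (x • b₀ + y • b₁) * b₁ - b₁ * (x • b₀ + y • b₁) := by
      simp only [add_mul, mul_add, smul_mul_assoc, mul_smul_comm, smul_sub]
      abel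
    rw [h, ← h1, one_mul, mul_one, sub_self]
  have hy : y • (b₀ * b₁ - b₁ * b₀) = 0 := by
    have h : y • (b₀ * b₁ - b₁ * b₀) =
        b₀ * (x • b₀ + y • b₁) - (x • b₀ + y • b₁) * b₀ := by
      simp only [add_mul, mul_add, smul_mul_assoc, mul_smul_comm, smul_sub]
      abel
    rw [h, ← h1, one_mul, mul_one, sub_self]
  have hcomm : b₀ * b₁ = b₁ * b₀ := by
    rw [← sub_eq_zero, ← one_smul R (b₀ * b₁ - b₁ * b₀), ← hunit, add_smul, mul_comm x,
      mul_comm y, mul_smul, mul_smul, hx, hy, smul_zero, smul_zero, add_zero]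
  obtain ⟨c, d, rfl⟩ := hB.exists_eq hs
  obtain ⟨c', d', rfl⟩ := hB.exists_eq ht
  change (c • b₀ + d • b₁) * (c' • b₀ + d' • b₁) = (c' • b₀ + d' • b₁) * (c • b₀ + d • b₁)
  simp only [add_mul, mul_add, smul_mul_assoc, mul_smul_comm, hcomm]
  module

/-- At every prime some `ρ g` is not scalar modulo the prime, as otherwise the two members of `B`
which span the algebra generated by `ρ` would be linearly dependent there. As `tr² - 4 det`
vanishes, a nonscalar matrix over a field has a nonzero entry off the diagonal. -/
theorem Splits.exists_notMem (hB : Splits ρ B)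
    (hm : ∀ s ∈ Algebra.adjoin R (Set.range ρ), m s = 0) (p : Ideal R) [hp : p.IsPrime] :
    ∃ g, ρ g 0 1 ∉ p ∨ ρ g 1 0 ∉ p := by
  by_contra! hcon
  have hoff (s) (hs : s ∈ Algebra.adjoin R (Set.range ρ)) : s 0 1 ∈ p ∧ s 1 0 ∈ p := by
    induction hs using Algebra.adjoin_induction with
    | mem x hx => obtain ⟨g, rfl⟩ := hx; exact hcon g
    | algebraMap r => simp [Matrix.algebraMap_matrix_apply]
    | add x y _ _ hx hy =>
      exact ⟨p.add_mem hx.1 hy.1, p.add_mem hx.2 hy.2⟩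
    | mul x y _ _ hx hy =>
      simp only [Matrix.mul_apply, Fin.sum_univ_two]
      exact ⟨p.add_mem (p.mul_mem_left _ hy.1) (p.mul_mem_right _ hx.1),
        p.add_mem (p.mul_mem_right _ hx.2) (p.mul_mem_left _ hy.2)⟩
  have hdiag (s) (hs : s ∈ Algebra.adjoin R (Set.range ρ)) : s 0 0 - s 1 1 ∈ p := by
    apply hp.mem_of_pow_mem 2
    have h := hm s hs
    simp only [m, Matrix.trace_fin_two, Matrix.det_fin_two] at h
    have h' : (s 0 0 - s 1 1) ^ 2 = -4 * s 1 0 * s 0 1 := by linear_combination h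
    rw [h']
    exact p.mul_mem_left _ (hoff s hs).1
  have hcoord (s : Matrix (Fin 2) (Fin 2) R) (hs : ∀ i j, s i j ∈ p) (k) : B.repr s k ∈ p := by
    rw [Matrix.matrix_eq_sum_single s]
    simp only [map_sum, Finsupp.coe_finsetSum, Finset.sum_apply]
    refine p.sum_mem fun i _ => p.sum_mem fun j _ => ?_
    have : Matrix.single i j (s i j) = s i j • Matrix.single i j (1 : R) := by simp
    rw [this, map_smul]
    exact p.mul_mem_right _ (hs i j)
  set b₀ := B (Sum.inl 0) with hb₀
  set b₁ := B (Sum.inl 1) with hb₁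
  obtain ⟨o01, o10⟩ := hoff _ (hB.basis_mem 0)
  obtain ⟨o01', o10'⟩ := hoff _ (hB.basis_mem 1)
  have d0 := hdiag _ (hB.basis_mem 0)
  have d1 := hdiag _ (hB.basis_mem 1)
  -- Modulo `p` both basis vectors are scalar, so `b₀ 0 0 • b₁ - b₁ 0 0 • b₀` vanishes there.
  have hdep (i j) : (b₀ 0 0 • b₁ - b₁ 0 0 • b₀) i j ∈ p := by
    fin_cases i <;> fin_cases j <;> simp only [Matrix.sub_apply, Matrix.smul_apply, smul_eq_mul,
      Fin.zero_eta, Fin.mk_one]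
    · rw [mul_comm, sub_self]; exact p.zero_mem
    · exact p.sub_mem (p.mul_mem_left _ o01') (p.mul_mem_left _ o01)
    · exact p.sub_mem (p.mul_mem_left _ o10') (p.mul_mem_left _ o10)
    · have : b₀ 0 0 * b₁ 1 1 - b₁ 0 0 * b₀ 1 1 =
          b₁ 0 0 * (b₀ 0 0 - b₀ 1 1) - b₀ 0 0 * (b₁ 0 0 - b₁ 1 1) := by ring
      rw [this]
      exact p.sub_mem (p.mul_mem_left _ d0) (p.mul_mem_left _ d1)
  have h00 : b₀ 0 0 ∈ p := by
    have := hcoord _ hdep (Sum.inl 1)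
    simpa [hb₀, hb₁] using this
  have h11 : b₀ 1 1 ∈ p := by
    have : b₀ 1 1 = b₀ 0 0 - (b₀ 0 0 - b₀ 1 1) := by ring
    rw [this]
    exact p.sub_mem h00 d0
  have hall (i j) : b₀ i j ∈ p := by
    fin_cases i <;> fin_cases j
    exacts [h00, o01, o10, h11]
  have := hcoord _ hall (Sum.inl 0)
  simp only [hb₀, Module.Basis.repr_self, Finsupp.single_eq_same] at this
  exact hp.ne_top ((Ideal.eq_top_iff_one p).2 this)

/-- A traceless matrix `N` of determinant zero with an invertible entry off the diagonal is
conjugate to `E₁₂`: for a suitable standard vector `v`, pass to the basis `N v, v`. -/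
theorem exists_mul_eq_nilpotent {N : Matrix (Fin 2) (Fin 2) R} (htr : N 1 1 = -N 0 0)
    (hdet : N 0 0 ^ 2 + N 0 1 * N 1 0 = 0) (hu : IsUnit (N 0 1) ∨ IsUnit (N 1 0)) :
    ∃ P : (Matrix (Fin 2) (Fin 2) R)ˣ,
      (P : Matrix (Fin 2) (Fin 2) R) * N = !![0, 1; 0, 0] * (P : Matrix (Fin 2) (Fin 2) R) := by
  suffices ∃ P : (Matrix (Fin 2) (Fin 2) R)ˣ,
      N * (P : Matrix (Fin 2) (Fin 2) R) = (P : Matrix (Fin 2) (Fin 2) R) * !![0, 1; 0, 0] by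
    obtain ⟨P, hP⟩ := this
    refine ⟨P⁻¹, ?_⟩
    rw [Units.inv_mul_eq_iff_eq_mul, ← mul_assoc, ← hP, mul_assoc, Units.mul_inv, mul_one]
  rcases hu with hu | hu
  · have hP : IsUnit (!![N 0 1, 0; N 1 1, 1] : Matrix (Fin 2) (Fin 2) R) := by
      rw [Matrix.isUnit_iff_isUnit_det]
      simpa using hu
    obtain ⟨P, hP⟩ := hP
    refine ⟨P, ?_⟩
    rw [hP]
    ext i j
    fin_cases i <;> fin_cases j <;> simp [Matrix.mul_apply, Fin.sum_univ_two, htr]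
    · ring
    · linear_combination hdet
  · have hP : IsUnit (!![N 0 0, 1; N 1 0, 0] : Matrix (Fin 2) (Fin 2) R) := by
      rw [Matrix.isUnit_iff_isUnit_det]
      simpa using hu
    obtain ⟨P, hP⟩ := hP
    refine ⟨P, ?_⟩
    rw [hP]
    ext i j
    fin_cases i <;> fin_cases j <;> simp [Matrix.mul_apply, Fin.sum_univ_two, htr]
    · linear_combination hdet
    · ring

/-- A representation into a commutative algebra on which `tr² - 4 det` vanishes, some member of
which has an invertible entry off the diagonal, is equivalent to a normal form. -/
theorem exists_normalForm (h2 : IsUnit (2 : R))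
    (hcomm : ∀ g h, ρ g * ρ h = ρ h * ρ g) (hm : ∀ g, m (ρ g) = 0)
    {g₀ : G} (hu : IsUnit (ρ g₀ 0 1) ∨ IsUnit (ρ g₀ 1 0)) :
    ∃ (a : NormalForm G R) (σ : Matrix (Fin 2) (Fin 2) R ≃ₐ[R] Matrix (Fin 2) (Fin 2) R),
      ∀ g, σ (ρ g) = a.rep g := by
  obtain ⟨t, ht⟩ := h2.exists_right_inv
  -- The character is half the trace.
  let χ (g : G) : R := t * (ρ g).trace
  have hχ (g : G) : 2 * χ g = ρ g 0 0 + ρ g 1 1 := by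
    simp only [χ, Matrix.trace_fin_two]
    linear_combination (ρ g 0 0 + ρ g 1 1) * ht
  let N : Matrix (Fin 2) (Fin 2) R := ρ g₀ - χ g₀ • 1
  have N00 : N 0 0 = ρ g₀ 0 0 - χ g₀ := by simp [N]
  have N01 : N 0 1 = ρ g₀ 0 1 := by simp [N]
  have N10 : N 1 0 = ρ g₀ 1 0 := by simp [N]
  have N11 : N 1 1 = ρ g₀ 1 1 - χ g₀ := by simp [N]
  have h4 : IsUnit (4 : R) := by
    have : (4 : R) = 2 * 2 := by norm_num
    rw [this]; exact h2.mul h2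
  -- A traceless matrix which commutes with `N` is the multiple of `N` determined by the entry in
  -- the position where `N` is invertible.
  have hlin (g : G) : ∃ d : R, ρ g = χ g • 1 + d • N := by
    have c00 := congrFun (congrFun (hcomm g g₀) 0) 0
    have c01 := congrFun (congrFun (hcomm g g₀) 0) 1
    have c10 := congrFun (congrFun (hcomm g g₀) 1) 0
    simp only [Matrix.mul_apply, Fin.sum_univ_two] at c00 c01 c10
    have hg := hχ g
    have hg₀ := hχ g₀
    rcases hu with hu | hu
    · obtain ⟨v, hv⟩ := hu.exists_right_inv
      refine ⟨ρ g 0 1 * v, ?_⟩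
      have e00 : ρ g 0 0 - χ g = ρ g 0 1 * v * N 0 0 := by
        rw [N00, ← h2.mul_right_inj]
        linear_combination v * c01 + (ρ g 1 1 - ρ g 0 0) * hv - hg + v * ρ g 0 1 * hg₀
      have e10 : ρ g 1 0 = ρ g 0 1 * v * N 1 0 := by
        rw [N10]
        linear_combination (-v) * c00 - ρ g 1 0 * hv
      ext i j
      fin_cases i <;> fin_cases j <;> simp only [Matrix.add_apply, Matrix.smul_apply, smul_eq_mul,
        Fin.zero_eta, Fin.mk_one, Matrix.one_apply_eq, ne_eq, Matrix.one_apply_ne, zero_ne_one,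
        not_false_eq_true, one_ne_zero, mul_one, mul_zero, zero_add]
      · linear_combination e00
      · rw [N01]; linear_combination (-ρ g 0 1) * hv
      · exact e10
      · rw [N11]; rw [N00] at e00
        linear_combination (-1) * e00 - hg + v * ρ g 0 1 * hg₀
    · obtain ⟨v, hv⟩ := hu.exists_right_inv
      refine ⟨ρ g 1 0 * v, ?_⟩
      have e00 : ρ g 0 0 - χ g = ρ g 1 0 * v * N 0 0 := by
        rw [N00, ← h2.mul_right_inj]
        linear_combination (-v) * c10 + (ρ g 1 1 - ρ g 0 0) * hv - hg + v * ρ g 1 0 * hg₀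
      have e01 : ρ g 0 1 = ρ g 1 0 * v * N 0 1 := by
        rw [N01]
        linear_combination v * c00 - ρ g 0 1 * hv
      ext i j
      fin_cases i <;> fin_cases j <;> simp only [Matrix.add_apply, Matrix.smul_apply, smul_eq_mul,
        Fin.zero_eta, Fin.mk_one, Matrix.one_apply_eq, ne_eq, Matrix.one_apply_ne, zero_ne_one,
        not_false_eq_true, one_ne_zero, mul_one, mul_zero, zero_add]
      · linear_combination e00
      · exact e01
      · rw [N10]; linear_combination (-ρ g 1 0) * hv
      · rw [N11]; rw [N00] at e00
        linear_combination (-1) * e00 - hg + v * ρ g 1 0 * hg₀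
  choose d hd using hlin
  obtain ⟨P, hP⟩ : ∃ P : (Matrix (Fin 2) (Fin 2) R)ˣ,
      (P : Matrix (Fin 2) (Fin 2) R) * N = !![0, 1; 0, 0] * (P : Matrix (Fin 2) (Fin 2) R) := by
    apply exists_mul_eq_nilpotent
    · rw [N00, N11]
      linear_combination -hχ g₀
    · rw [N00, N01, N10, ← h4.mul_right_inj]
      have h := hm g₀
      simp only [m, Matrix.trace_fin_two, Matrix.det_fin_two] at h
      have hg₀ := hχ g₀
      linear_combination h + (2 * χ g₀ - 3 * ρ g₀ 0 0 + ρ g₀ 1 1) * hg₀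
    · rwa [N01, N10]
  have hσ (g : G) : conjAlgEquiv P (ρ g) = !![χ g, d g; 0, χ g] := by
    rw [hd g, map_add, map_smul, map_smul, map_one, conjAlgEquiv_eq_of_mul_eq P hP]
    ext i j
    fin_cases i <;> fin_cases j <;> simp
  have hmul (g h : G) : !![χ (g * h), d (g * h); 0, χ (g * h)] =
      !![χ g, d g; 0, χ g] * !![χ h, d h; 0, χ h] := by
    rw [← hσ, ← hσ, ← hσ, map_mul, map_mul]
  have hone : !![χ 1, d 1; 0, χ 1] = 1 := by rw [← hσ, map_one, map_one]
  -- `d g₀ = 1` because the off-diagonal entry of `ρ g₀` is a unit, and equals that of `N`.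
  have hbase : d g₀ = 1 := by
    have h : d g₀ • N = N := by
      have := hd g₀
      rw [← sub_eq_iff_eq_add'] at this
      exact this.symm
    rcases hu with hu | hu
    · have := congrFun (congrFun h 0) 1
      rw [Matrix.smul_apply, smul_eq_mul, N01] at this
      exact hu.mul_right_cancel (this.trans (one_mul _).symm)
    · have := congrFun (congrFun h 1) 0
      rw [Matrix.smul_apply, smul_eq_mul, N10] at this
      exact hu.mul_right_cancel (this.trans (one_mul _).symm)
  refine ⟨{ char := ⟨⟨χ, by simpa using congrFun (congrFun hone 0) 0⟩,
              fun g h => by simpa using congrFun (congrFun (hmul g h) 0) 0⟩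
            der := d
            base := g₀
            der_mul := fun g h => ?_
            der_base := hbase }, conjAlgEquiv P, hσ⟩
  have := congrFun (congrFun (hmul g h) 0) 1
  simpa [mul_comm] using this

end LocalStructure

/-! ### Standard charts of the projective spectrum of a symmetric algebra -/

section Charts

open HomogeneousLocalization

variable {R M : Type u} [CommRing R] [AddCommGroup M] [Module R M] {B : Type*} [CommRing B]

theorem ι_mem_symGrading (x : M) : SymmetricAlgebra.ι R M x ∈ symGrading R M 1 := by
  simp [symGrading]

variable (R) in
/-- The structure morphism `R → S(M)_(f)`. -/
def awayBase (f : SymmetricAlgebra R M) : R →+* Away (symGrading R M) f :=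
  (fromZeroRingHom (symGrading R M) _).comp (algebraMap R (symGrading R M 0))

variable (R) in
/-- The fraction `x / y` of degree zero in `S(M)_(y)`. -/
def frac (x y : M) : Away (symGrading R M) (SymmetricAlgebra.ι R M y) :=
  Away.mk (symGrading R M) (ι_mem_symGrading y) 1 (SymmetricAlgebra.ι R M x)
    (ι_mem_symGrading x)

theorem val_awayBase (f : SymmetricAlgebra R M) (r : R) :
    (awayBase R f r).val = Localization.mk (algebraMap R _ r) 1 := rfl

theorem val_frac (x y : M) : (frac R x y).val =
    Localization.mk (SymmetricAlgebra.ι R M x)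
      ⟨SymmetricAlgebra.ι R M y ^ 1, (Submonoid.mem_powers_iff _ _).2 ⟨1, rfl⟩⟩ := rfl

theorem frac_self (x : M) : frac R x x = 1 := by
  ext
  rw [val_frac, val_one]
  simp only [pow_one]
  exact Localization.mk_self ⟨SymmetricAlgebra.ι R M x, _⟩

theorem frac_add (x x' y : M) : frac R (x + x') y = frac R x y + frac R x' y := by
  ext
  simp only [val_add, val_frac, map_add, Localization.add_mk_self]

theorem frac_smul (r : R) (x y : M) :
    frac R (r • x) y = awayBase R _ r * frac R x y := by
  ext
  rw [val_mul, val_frac, val_frac, val_awayBase, Localization.mk_mul, map_smul, one_mul,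
    Algebra.smul_def]

/-- The `R`-algebra `S(M)_(y)` is generated by the fractions `x / y`. -/
theorem away_hom_ext {y : M}
    {φ ψ : Away (symGrading R M) (SymmetricAlgebra.ι R M y) →+* B}
    (h : ∀ r, φ (awayBase R _ r) = ψ (awayBase R _ r))
    (h' : ∀ x, φ (frac R x y) = ψ (frac R x y)) : φ = ψ := by
  ext z
  obtain ⟨n, s, hs, rfl⟩ := Away.mk_surjective (symGrading R M) (ι_mem_symGrading y) z
  -- Induction on `n` for the fractions `s / y ^ n` with `s` of degree `n`.
  have key (n : ℕ) (s : SymmetricAlgebra R M)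
      (hs : s ∈ LinearMap.range (SymmetricAlgebra.ι R M) ^ n)
      (z : Away (symGrading R M) (SymmetricAlgebra.ι R M y))
      (hz : z.val = Localization.mk s
        ⟨SymmetricAlgebra.ι R M y ^ n, (Submonoid.mem_powers_iff _ _).2 ⟨n, rfl⟩⟩) : φ z = ψ z := by
    induction hs using Submodule.pow_induction_on_left' generalizing z with
    | algebraMap r =>
      have : z = awayBase R _ r := by
        ext
        rw [hz, val_awayBase]
        congr 1
        ext
        exact pow_zero _
      rw [this, h]
    | add s t i hs ht ihs iht =>
      have e : i = i • 1 := by simp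
      let a := Away.mk (symGrading R M) (ι_mem_symGrading y) i s (by rw [← e]; exact hs)
      let b := Away.mk (symGrading R M) (ι_mem_symGrading y) i t (by rw [← e]; exact ht)
      have : z = a + b := by
        ext
        rw [hz, val_add, Away.val_mk, Away.val_mk, Localization.add_mk_self]
      rw [this, map_add, map_add, ihs a rfl, iht b rfl]
    | mem_mul m hm i s hs ih =>
      obtain ⟨x, rfl⟩ := hm
      have e : i = i • 1 := by simp
      let a := Away.mk (symGrading R M) (ι_mem_symGrading y) i s (by rw [← e]; exact hs)
      have : z = frac R x y * a := by
        ext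
        rw [hz, val_mul, Away.val_mk, val_frac, Localization.mk_mul]
        congr 1
        ext
        exact (pow_succ' _ _).trans (congrArg (· * _) (pow_one _).symm)
      rw [this, map_mul, map_mul, ih a rfl, h']
  refine key n s ?_ _ rfl
  have e : n = n • 1 := by simp
  rw [e]; exact hs

/-- The homomorphism `S(M)_(f) → B` induced by a homomorphism `S(M) → B` which inverts `f`. -/
def awayEval (ψ : SymmetricAlgebra R M →+* B) {f : SymmetricAlgebra R M} (hf : IsUnit (ψ f)) :
    Away (symGrading R M) f →+* B :=
  (IsLocalization.Away.lift f hf).comp (algebraMap (Away (symGrading R M) f) (Localization.Away f))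

theorem awayEval_mk (ψ : SymmetricAlgebra R M →+* B) {f : SymmetricAlgebra R M} (hf : IsUnit (ψ f))
    {d : ℕ} (hd : f ∈ symGrading R M d) (n : ℕ) (s : SymmetricAlgebra R M)
    (hs : s ∈ symGrading R M (n • d)) :
    ψ f ^ n * awayEval ψ hf (Away.mk _ hd n s hs) = ψ s := by
  have h : algebraMap _ (Localization.Away f) f ^ n *
      algebraMap (Away (symGrading R M) f) (Localization.Away f) (Away.mk _ hd n s hs) =
      algebraMap _ (Localization.Away f) s := by
    rw [HomogeneousLocalization.algebraMap_apply, Away.val_mk, ← map_pow,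
      ← Localization.mk_one_eq_algebraMap, ← Localization.mk_one_eq_algebraMap, Localization.mk_mul,
      Localization.mk_eq_mk_iff, Localization.r_iff_exists]
    exact ⟨1, by simp⟩
  have := congrArg (IsLocalization.Away.lift (S := Localization.Away f) f hf) h
  rw [map_mul, map_pow, IsLocalization.Away.lift_eq, IsLocalization.Away.lift_eq] at this
  exact this

theorem awayEval_awayBase (ψ : SymmetricAlgebra R M →+* B) {f : SymmetricAlgebra R M}
    (hf : IsUnit (ψ f)) (r : R) : awayEval ψ hf (awayBase R f r) = ψ (algebraMap R _ r) :=
  IsLocalization.Away.lift_eq f hf _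

theorem awayMap_awayBase {f g x : SymmetricAlgebra R M} {e : ℕ} (hg : g ∈ symGrading R M e)
    (hx : x = f * g) (r : R) :
    awayMap (symGrading R M) hg hx (awayBase R f r) = awayBase R x r :=
  awayMap_fromZeroRingHom ..

/-- Passing from `S(M)_(y)` to `S(M)_(y y')`, the fraction `x / y'` becomes `y / y'` times
`x / y`. -/
theorem awayMap_frac (x y y' : M) {s : SymmetricAlgebra R M}
    (hs : s = SymmetricAlgebra.ι R M y * SymmetricAlgebra.ι R M y') :
    awayMap (symGrading R M) (ι_mem_symGrading y) (hs.trans (mul_comm _ _)) (frac R x y') =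
      awayMap (symGrading R M) (ι_mem_symGrading y) (hs.trans (mul_comm _ _)) (frac R y y') *
        awayMap (symGrading R M) (ι_mem_symGrading y') hs (frac R x y) := by
  subst hs
  ext
  rw [frac, frac, frac, awayMap_mk, awayMap_mk, awayMap_mk, val_mul, Away.val_mk, Away.val_mk,
    Away.val_mk, Localization.mk_mul, Localization.mk_eq_mk_iff, Localization.r_iff_exists]
  exact ⟨1, by simp; ring⟩

end Charts

/-! ### Morphisms into the charts of `Proj S(Ω_G)` -/

section Points

open HomogeneousLocalization

variable {G : Type u} [Monoid G] {B : Type u} [CommRing B]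

theorem isUnit_two_zHalf : IsUnit (2 : ZHalf.{u}) := by
  have h : IsUnit (2 : Localization.Away (2 : ℤ)) := by
    simpa using IsLocalization.Away.algebraMap_isUnit (S := Localization.Away (2 : ℤ)) (2 : ℤ)
  let e : Localization.Away (2 : ℤ) ≃+* ZHalf.{u} := ULift.ringEquiv.symm
  have he := h.map e
  rwa [map_ofNat] at he

instance (S : Type*) [CommRing S] : Subsingleton (ZHalf.{u} →+* S) := by
  refine ⟨fun φ ψ => ?_⟩
  let e : ZHalf.{u} ≃+* Localization.Away (2 : ℤ) := ULift.ringEquiv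
  have h : φ.comp e.symm.toRingHom = ψ.comp e.symm.toRingHom :=
    IsLocalization.ringHom_ext (Submonoid.powers (2 : ℤ)) (Subsingleton.elim _ _)
  ext x
  simpa using RingHom.congr_fun h (e x)

/-- A homomorphism from the coordinate ring is determined by a character; linearity over `ℤ[1/2]`
is automatic. -/
theorem coordRing_hom_ext {S : Type*} [CommRing S] {φ ψ : CoordRing G →+* S}
    (h : ∀ g, φ (univChar G g) = ψ (univChar G g)) : φ = ψ := by
  let _ := (φ.comp (algebraMap ZHalf.{u} (CoordRing G))).toAlgebra
  let φ' : CoordRing G →ₐ[ZHalf.{u}] S := { φ with commutes' := fun _ => rfl }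
  let ψ' : CoordRing G →ₐ[ZHalf.{u}] S :=
    { ψ with commutes' := fun r => RingHom.congr_fun (Subsingleton.elim
        (ψ.comp (algebraMap ZHalf.{u} (CoordRing G)))
        (φ.comp (algebraMap ZHalf.{u} (CoordRing G)))) r }
  have : φ' = ψ' := (univChar_universal G (φ.toMonoidHom.comp (univChar G))).unique
    (fun _ => rfl) (fun g => (h g).symm)
  ext x
  exact DFunLike.congr_fun this x

theorem span_univDer : Submodule.span (CoordRing G) (Set.range (univDer G)) = ⊤ := by
  have h : Set.range (univDer G) = (derRelations G).mkQ ''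
      Set.range fun g : G => Finsupp.single g (1 : CoordRing G) := by
    rw [← Set.range_comp]; rfl
  rw [h]
  refine (Submodule.map_span _ _).symm.trans ?_
  have h' : Submodule.span (CoordRing G)
      (Set.range fun g : G => Finsupp.single g (1 : CoordRing G)) = ⊤ := by
    simpa using (Finsupp.basisSingleOne (ι := G) (R := CoordRing G)).span_eq
  rw [h']
  exact (Submodule.map_top _).trans (Submodule.range_mkQ _)

variable (G) in
/-- The symbol `dg` as an element of degree one of `S(Ω_G)`. -/
abbrev symDer (g : G) : SymmetricAlgebra (CoordRing G) (Omega G) :=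
  SymmetricAlgebra.ι (CoordRing G) (Omega G) (univDer G g)

variable (G) in
/-- The coordinate ring of the chart of `Proj S(Ω_G)` on which `dg` is invertible. -/
abbrev ChartRing (g : G) : Type u :=
  Away (symGrading (CoordRing G) (Omega G)) (symDer G g)

theorem symDer_mem (g : G) : symDer G g ∈ symGrading (CoordRing G) (Omega G) 1 :=
  ι_mem_symGrading _

theorem chartRing_hom_ext {S : Type*} [CommRing S] {g : G} {φ ψ : ChartRing G g →+* S}
    (h : ∀ k, φ (awayBase (CoordRing G) _ (univChar G k)) =
      ψ (awayBase (CoordRing G) _ (univChar G k)))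
    (h' : ∀ k, φ (frac (CoordRing G) (univDer G k) (univDer G g)) =
      ψ (frac (CoordRing G) (univDer G k) (univDer G g))) : φ = ψ := by
  have hb : φ.comp (awayBase (CoordRing G) _) = ψ.comp (awayBase (CoordRing G) _) :=
    coordRing_hom_ext h
  refine away_hom_ext (fun r => RingHom.congr_fun hb r) fun x => ?_
  have hx : x ∈ Submodule.span (CoordRing G) (Set.range (univDer G)) := by
    rw [span_univDer]; exact Submodule.mem_top
  induction hx using Submodule.span_induction with
  | mem x hx => obtain ⟨k, rfl⟩ := hx; exact h' k
  | zero =>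
    have h0 : frac (CoordRing G) (0 : Omega G) (univDer G g) = 0 := by
      simpa using frac_smul (0 : CoordRing G) (0 : Omega G) (univDer G g)
    rw [h0, map_zero, map_zero]
  | add x y _ _ hx hy => rw [frac_add, map_add, map_add, hx, hy]
  | smul r x _ hx =>
    rw [frac_smul, map_mul, map_mul, hx]
    congr 1
    exact RingHom.congr_fun hb r

/-- The normal form given by a point of a chart: the character is the restriction of the point
to `Rep₁`, and the derivation is `k ↦ dk / dg`. -/
def normalFormOfHom {S : Type*} [CommRing S] {g : G} (φ : ChartRing G g →+* S) :
    NormalForm G S where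
  char := (φ.comp (awayBase (CoordRing G) _)).toMonoidHom.comp (univChar G)
  der k := φ (frac (CoordRing G) (univDer G k) (univDer G g))
  base := g
  der_mul k l := by
    rw [isDerivation_univDer G k l, frac_add, frac_smul, frac_smul, map_add, map_mul, map_mul]
    rfl
  der_base := by rw [frac_self, map_one]

/-- Every normal form over a `ℤ[1/2]`-algebra defines a homomorphism from `S(Ω_G)`. -/
theorem NormalForm.exists_symHom (h : Nonempty (ZHalf.{u} →+* B)) (a : NormalForm G B) :
    ∃ ψ : SymmetricAlgebra (CoordRing G) (Omega G) →+* B,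
      (∀ k, ψ (algebraMap _ _ (univChar G k)) = a.char k) ∧ ∀ k, ψ (symDer G k) = a.der k := by
  obtain ⟨z⟩ := h
  let _ := z.toAlgebra
  obtain ⟨φ, hφ, -⟩ := univChar_universal G a.char
  let _ := φ.toRingHom.toAlgebra
  have hsmul (k : G) (b : B) : univChar G k • b = a.char k * b := by
    rw [Algebra.smul_def]
    congr 1
    exact hφ k
  obtain ⟨f, hf, -⟩ := univDer_universal G a.der fun k l => by
    rw [hsmul, hsmul, a.der_mul]
  refine ⟨(SymmetricAlgebra.lift f).toRingHom, fun k => ?_, fun k => ?_⟩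
  · exact ((SymmetricAlgebra.lift f).commutes _).trans (hφ k)
  · exact (SymmetricAlgebra.lift_ι_apply f _).trans (hf k)

theorem normalFormOfHom_awayEval {ψ : SymmetricAlgebra (CoordRing G) (Omega G) →+* B}
    {a : NormalForm G B} (h : ∀ k, ψ (algebraMap _ _ (univChar G k)) = a.char k)
    (h' : ∀ k, ψ (symDer G k) = a.der k) (hu : IsUnit (ψ (symDer G a.base))) :
    normalFormOfHom (awayEval ψ hu) = a := by
  ext k
  · exact (awayEval_awayBase ψ hu _).trans (h k)
  · have := awayEval_mk ψ hu (symDer_mem a.base) 1 (symDer G k) (symDer_mem k)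
    rw [h', h', a.der_base, one_pow, one_mul] at this
    exact this
  · rfl

theorem NormalForm.exists_normalFormOfHom (h : Nonempty (ZHalf.{u} →+* B)) (a : NormalForm G B) :
    ∃ φ : ChartRing G a.base →+* B, normalFormOfHom φ = a := by
  obtain ⟨ψ, h1, h2⟩ := a.exists_symHom h
  have hu : IsUnit (ψ (symDer G a.base)) := by rw [h2, a.der_base]; exact isUnit_one
  exact ⟨awayEval ψ hu, normalFormOfHom_awayEval h1 h2 hu⟩

theorem normalFormOfHom_injective {S : Type*} [CommRing S] {g : G} {φ ψ : ChartRing G g →+* S}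
    (h : normalFormOfHom φ = normalFormOfHom ψ) : φ = ψ :=
  chartRing_hom_ext (fun k => DFunLike.congr_fun (congrArg NormalForm.char h) k)
    (fun k => congrFun (congrArg NormalForm.der h) k)

/-- Points of two charts give proportional normal forms if and only if both come from a point
of the intersection of the charts. -/
theorem exists_awayMap_iff {g k : G} (φ : ChartRing G g →+* B) (ψ : ChartRing G k →+* B)
    (h : Nonempty (ZHalf.{u} →+* B)) :
    (∃ ζ : Away (symGrading (CoordRing G) (Omega G)) (symDer G g * symDer G k) →+* B,
      ζ.comp (awayMap (symGrading (CoordRing G) (Omega G)) (symDer_mem k) rfl) = φ ∧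
      ζ.comp (awayMap (symGrading (CoordRing G) (Omega G)) (symDer_mem g) (mul_comm _ _)) = ψ) ↔
    (normalFormOfHom φ).Proportional (normalFormOfHom ψ) := by
  constructor
  · rintro ⟨ζ, rfl, rfl⟩
    constructor
    · ext l
      change ζ (awayMap _ _ _ (awayBase _ _ _)) = ζ (awayMap _ _ _ (awayBase _ _ _))
      rw [awayMap_awayBase, awayMap_awayBase]
    · intro l
      change ζ (awayMap _ _ _ (frac _ _ _)) = ζ (awayMap _ _ _ (frac _ _ _)) *
        ζ (awayMap _ _ _ (frac _ _ _))
      exact (congrArg ζ (awayMap_frac (univDer G l) (univDer G g) (univDer G k) rfl)).trans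
        (map_mul ζ _ _)
  · intro hp
    set a := normalFormOfHom φ with ha
    set b := normalFormOfHom ψ with hb
    -- The homomorphism from `S(Ω_G)` given by `a` inverts both `dg` and `dk`.
    obtain ⟨χ, h1, h2⟩ := a.exists_symHom h
    have hk : b.der g * a.der k = 1 := (hp.2 k).symm.trans b.der_base
    have hg1 : χ (symDer G g) = 1 := (h2 g).trans a.der_base
    have hu : IsUnit (χ (symDer G g * symDer G k)) := by
      rw [map_mul, hg1, one_mul, h2]
      exact .of_mul_eq_one_right _ hk
    have hval : χ (symDer G g * symDer G k) = a.der k := by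
      rw [map_mul, hg1, one_mul, h2]
    have hku : IsUnit (a.der k) := hval ▸ hu
    have hmem := SetLike.mul_mem_graded (symDer_mem g) (symDer_mem k)
    refine ⟨awayEval χ hu, normalFormOfHom_injective ?_, normalFormOfHom_injective ?_⟩
    · rw [← ha]
      ext l
      · change awayEval χ hu (awayMap _ _ _ (awayBase _ _ _)) = _
        rw [awayMap_awayBase, awayEval_awayBase, h1]
      · change awayEval χ hu (awayMap _ _ _ (Away.mk _ _ _ _ _)) = _
        have := awayEval_mk χ hu hmem 1 (symDer G l * symDer G k ^ 1)
          (by rw [pow_one]; exact SetLike.mul_mem_graded (symDer_mem l) (symDer_mem k))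
        rw [awayMap_mk]
        rw [hval, pow_one (a.der k), map_mul χ, map_pow, pow_one (χ _), h2, h2, mul_comm] at this
        exact hku.mul_right_cancel this
      · rfl
    · rw [← hb]
      ext l
      · change awayEval χ hu (awayMap _ _ _ (awayBase _ _ _)) = _
        rw [awayMap_awayBase, awayEval_awayBase, h1, hp.1]
      · change awayEval χ hu (awayMap _ _ _ (Away.mk _ _ _ _ _)) = _
        have := awayEval_mk χ hu hmem 1 (symDer G l * symDer G g ^ 1)
          (by rw [pow_one]; exact SetLike.mul_mem_graded (symDer_mem l) (symDer_mem g))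
        rw [awayMap_mk]
        rw [hval, pow_one (a.der k), map_mul χ, map_pow, pow_one (χ _), hg1, h2, mul_one] at this
        apply hku.mul_left_cancel
        refine this.trans ?_
        rw [hp.2 l, ← mul_assoc, mul_comm (a.der k)]
        change _ = b.der g * a.der k * _
        rw [hk, one_mul]
      · rfl

end Points

/-! ### Representations with unipotent mold are locally equivalent to normal forms -/

section LocalNormalForm

variable {X : Scheme.{u}} {G : Type u} [Monoid G]

theorem NormalForm.hasUnipotentMold (a : NormalForm G Γ(X, ⊤)) : HasUnipotentMold a.rep := by
  have key (U : X.Opens) : ∃ B : Module.Basis (Fin 2 ⊕ Fin 2) Γ(X, U) (Matrix _ _ Γ(X, U)),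
      Splits (resRep a.rep U) B ∧ m (B (Sum.inl 0)) = 0 ∧ m (B (Sum.inl 1)) = 0 ∧
        m (B (Sum.inl 0) + B (Sum.inl 1)) = 0 := by
    obtain ⟨B, h0, h1⟩ := NormalForm.exists_basis Γ(X, U)
    refine ⟨B, ?_, ?_⟩
    · rw [resRep, NormalForm.mapRep_rep]
      exact NormalForm.splits_rep _ B h0 h1
    · rw [h0, h1]
      refine ⟨?_, ?_, ?_⟩ <;> simp [m, Matrix.trace_fin_two, Matrix.det_fin_two] <;> norm_num
  obtain ⟨hM, hR⟩ := isMold_of_splits (ρ := a.rep) (r := 2) fun x => by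
    obtain ⟨B, hB, -⟩ := key ⊤
    exact ⟨⊤, trivial, 2, B, hB⟩
  refine ⟨hM, hR, fun U s hs => ?_⟩
  obtain ⟨B, hB, m0, m1, m2⟩ := key U
  rw [hB.mem_generated_iff] at hs
  rw [← B.sum_repr s, Fintype.sum_sum_type, Fin.sum_univ_two]
  simp only [hs, zero_smul, Finset.sum_const_zero, add_zero]
  exact m_comb _ _ _ _ m0 m1 m2

/-- Around every point, a representation with unipotent mold is equivalent to a normal form. -/
theorem exists_normalForm_nhds {ρ : Rep X 2 G} (hρ : HasUnipotentMold ρ)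
    (h2 : IsUnit (2 : Γ(X, ⊤))) (x : X) :
    ∃ (V : X.Opens) (_ : x ∈ V) (a : NormalForm G Γ(V, ⊤)),
      Equivalent (pullRep V.ι ρ) a.rep := by
  obtain ⟨V₀, hx, q, B, hB⟩ := exists_splits hρ.isMold hρ.hasRank x
  have hm (s) (hs : s ∈ Algebra.adjoin Γ(X, V₀) (Set.range (resRep ρ V₀))) : m s = 0 :=
    hρ.m_eq_zero V₀ s (adjoin_le_generated ρ hs)
  obtain ⟨g, hg⟩ := hB.exists_notMem hm
    ((IsLocalRing.maximalIdeal (X.presheaf.stalk x)).comap (X.presheaf.germ V₀ x hx).hom)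
  -- It suffices to find a neighbourhood on which an entry off the diagonal is invertible.
  suffices key : ∀ r : Γ(X, V₀), (r = resRep ρ V₀ g 0 1 ∨ r = resRep ρ V₀ g 1 0) →
      r ∉ (IsLocalRing.maximalIdeal (X.presheaf.stalk x)).comap
        (X.presheaf.germ V₀ x hx).hom →
      ∃ (V : X.Opens) (_ : x ∈ V) (a : NormalForm G Γ(V, ⊤)),
        Equivalent (pullRep V.ι ρ) a.rep by
    rcases hg with hg | hg
    · exact key _ (Or.inl rfl) hg
    · exact key _ (Or.inr rfl) hg
  intro r hr hrx
  have hxr : x ∈ X.basicOpen r := by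
    rw [Scheme.mem_basicOpen _ _ _ hx]
    simpa using hrx
  have hle : X.basicOpen r ≤ V₀ := X.basicOpen_le r
  let V := X.basicOpen r
  have e : (⊤ : V.toScheme.Opens) ≤ V.ι ⁻¹ᵁ V₀ := by
    intro y _
    exact hle y.2
  let θ : Γ(X, V₀) →+* Γ(V, ⊤) := (V.ι.appLE V₀ ⊤ e).hom
  have hθ : mapRep θ (resRep ρ V₀) = pullRep V.ι ρ := by
    ext k i j
    have := CommRingCat.comp_apply (X.presheaf.map (homOfLE (le_top : V₀ ≤ ⊤)).op)
      (V.ι.appLE V₀ ⊤ e) (ρ k i j)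
    refine Eq.trans this.symm ?_
    rw [Scheme.Hom.map_appLE]
    change (V.ι.appLE ⊤ ⊤ _) _ = V.ι.appTop _
    rw [Scheme.Hom.appTop, Scheme.Hom.app_eq_appLE]
    rfl
  have hu : IsUnit (θ r) := by
    have h1 := X.toRingedSpace.isUnit_res_basicOpen r
    have e' : (⊤ : V.toScheme.Opens) ≤ V.ι ⁻¹ᵁ V := fun y _ => y.2
    have h3 := h1.map (V.ι.appLE V ⊤ e').hom
    have h4 := CommRingCat.comp_apply (X.presheaf.map (homOfLE hle).op) (V.ι.appLE V ⊤ e') r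
    rw [Scheme.Hom.map_appLE] at h4
    have h5 : θ r = _ := h4
    rw [h5]
    exact h3
  have h2' : IsUnit (2 : Γ(V, ⊤)) := by
    have := h2.map V.ι.appTop.hom
    rwa [map_ofNat] at this
  obtain ⟨a, σ, hσ⟩ := exists_normalForm (ρ := mapRep θ (resRep ρ V₀)) h2'
    (fun k l => by
      have h := congrArg θ.mapMatrix
        (hB.commute (Algebra.subset_adjoin ⟨k, rfl⟩) (Algebra.subset_adjoin ⟨l, rfl⟩))
      rwa [map_mul θ.mapMatrix, map_mul θ.mapMatrix] at h)
    (fun k => by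
      refine (m_map θ _).trans ?_
      rw [hm _ (Algebra.subset_adjoin ⟨k, rfl⟩), map_zero])
    (g₀ := g) (by
      rcases hr with rfl | rfl
      · exact Or.inl hu
      · exact Or.inr hu)
  rw [hθ] at hσ
  exact ⟨V, hxr, a, σ, hσ⟩

end LocalNormalForm

/-! ### Morphisms to the moduli scheme -/

section Morphisms

variable {X Y : Scheme.{u}}

/-- The morphism to an affine scheme defined by a ring homomorphism. -/
def specMor {R : Type u} [CommRing R] (φ : R →+* Γ(X, ⊤)) : X ⟶ Spec (CommRingCat.of R) :=
  X.toSpecΓ ≫ Spec.map (CommRingCat.ofHom φ)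

theorem specMor_bijective (X : Scheme.{u}) (R : Type u) [CommRing R] :
    Function.Bijective (specMor (X := X) (R := R)) := by
  let e : (R →+* Γ(X, ⊤)) ≃ (X ⟶ Spec (CommRingCat.of R)) :=
    (ConcreteCategory.homEquiv (X := CommRingCat.of R) (Y := Γ(X, ⊤))).symm.trans
      ((Quiver.Hom.opEquiv).trans (ΓSpec.adjunction.homEquiv X (op (CommRingCat.of R))))
  exact e.bijective

theorem comp_specMor {R : Type u} [CommRing R] (f : Y ⟶ X) (φ : R →+* Γ(X, ⊤)) :
    f ≫ specMor φ = specMor (f.appTop.hom.comp φ) := by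
  rw [specMor, Scheme.toSpecΓ_naturality_assoc, ← Spec.map_comp]
  rfl

theorem specMor_comp {R S : Type u} [CommRing R] [CommRing S] (φ : S →+* Γ(X, ⊤))
    (θ : R →+* S) : specMor φ ≫ Spec.map (CommRingCat.ofHom θ) = specMor (φ.comp θ) := by
  rw [specMor, Category.assoc, ← Spec.map_comp]
  rfl

/-- As `ℤ[1/2]` is a localization of `ℤ`, there is at most one structure of a scheme over it. -/
instance : Subsingleton (X ⟶ SpecZHalf.{u}) := by
  refine ⟨fun f g => ?_⟩
  obtain ⟨φ, rfl⟩ := (specMor_bijective X _).2 f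
  obtain ⟨ψ, rfl⟩ := (specMor_bijective X _).2 g
  rw [Subsingleton.elim φ ψ]

theorem nonempty_zHalf_hom (f : X ⟶ SpecZHalf.{u}) : Nonempty (ZHalf.{u} →+* Γ(X, ⊤)) := by
  obtain ⟨φ, -⟩ := (specMor_bijective X _).2 f
  exact ⟨φ⟩

theorem isUnit_two_of_hom {B : Type*} [CommRing B] (h : Nonempty (ZHalf.{u} →+* B)) :
    IsUnit (2 : B) := by
  obtain ⟨φ⟩ := h
  have := isUnit_two_zHalf.map φ
  rwa [map_ofNat] at this

variable {G : Type u} [Monoid G]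

variable (G) in
/-- The open immersion of the chart on which `dg` is invertible. -/
def chartι (g : G) : Spec (CommRingCat.of (ChartRing G g)) ⟶ ProjSym (CoordRing G) (Omega G) :=
  Proj.awayι (symGrading (CoordRing G) (Omega G)) (symDer G g) (symDer_mem g) one_pos

instance (g : G) : IsOpenImmersion (chartι G g) :=
  inferInstanceAs (IsOpenImmersion (Proj.awayι (symGrading (CoordRing G) (Omega G)) (symDer G g)
    (symDer_mem g) one_pos))

/-- The morphism to `Proj S(Ω_G)` defined by a point of a chart. -/
def chartMor {g : G} (φ : ChartRing G g →+* Γ(X, ⊤)) : X ⟶ ProjSym (CoordRing G) (Omega G) :=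
  specMor φ ≫ chartι G g

theorem comp_chartMor (f : Y ⟶ X) {g : G} (φ : ChartRing G g →+* Γ(X, ⊤)) :
    f ≫ chartMor φ = chartMor (f.appTop.hom.comp φ) := by
  rw [chartMor, ← Category.assoc, comp_specMor]
  rfl

/-- Two points of charts define the same morphism if and only if their normal forms are
proportional, because the intersection of two charts is the chart of the product. -/
theorem chartMor_eq_iff (h : Nonempty (ZHalf.{u} →+* Γ(X, ⊤))) {g k : G}
    (φ : ChartRing G g →+* Γ(X, ⊤)) (ψ : ChartRing G k →+* Γ(X, ⊤)) :
    chartMor φ = chartMor ψ ↔ (normalFormOfHom φ).Proportional (normalFormOfHom ψ) := by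
  rw [← exists_awayMap_iff φ ψ h]
  constructor
  · intro heq
    obtain ⟨p, hp, hp'⟩ : ∃ p : X ⟶ Limits.pullback
        (Proj.awayι (symGrading (CoordRing G) (Omega G)) (symDer G g) (symDer_mem g) one_pos)
        (Proj.awayι (symGrading (CoordRing G) (Omega G)) (symDer G k) (symDer_mem k) one_pos),
        p ≫ Limits.pullback.fst _ _ = specMor φ ∧ p ≫ Limits.pullback.snd _ _ = specMor ψ :=
      ⟨Limits.pullback.lift _ _ heq, Limits.pullback.lift_fst .., Limits.pullback.lift_snd ..⟩
    obtain ⟨ζ, hζ⟩ := (specMor_bijective X _).2 (p ≫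
      (Proj.pullbackAwayιIso (symGrading (CoordRing G) (Omega G)) (symDer_mem g) one_pos
        (symDer_mem k) one_pos rfl).hom)
    refine ⟨ζ, (specMor_bijective X _).1 ?_, (specMor_bijective X _).1 ?_⟩
    · rw [← specMor_comp, hζ, Category.assoc, Proj.pullbackAwayιIso_hom_SpecMap_awayMap_left, hp]
    · rw [← specMor_comp, hζ, Category.assoc, Proj.pullbackAwayιIso_hom_SpecMap_awayMap_right, hp']
  · rintro ⟨ζ, rfl, rfl⟩
    rw [chartMor, chartMor, ← specMor_comp, ← specMor_comp, Category.assoc, Category.assoc]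
    exact congrArg (specMor ζ ≫ ·) ((Proj.SpecMap_awayMap_awayι _ (symDer_mem g) one_pos
      (symDer_mem k) rfl).trans (Proj.SpecMap_awayMap_awayι _ (symDer_mem k) one_pos
      (symDer_mem g) (mul_comm _ _)).symm)

theorem adjoin_symDer : Algebra.adjoin (symGrading (CoordRing G) (Omega G) 0)
    (Set.range (symDer G)) = ⊤ := by
  rw [eq_top_iff]
  rintro s -
  have hbase (r : CoordRing G) : algebraMap _ _ r ∈
      Algebra.adjoin (symGrading (CoordRing G) (Omega G) 0) (Set.range (symDer G)) :=
    Subalgebra.algebraMap_mem _ (algebraMap (CoordRing G) (symGrading (CoordRing G) (Omega G) 0) r)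
  induction s using SymmetricAlgebra.induction with
  | algebraMap r => exact hbase r
  | ι x =>
    have hx : x ∈ Submodule.span (CoordRing G) (Set.range (univDer G)) := by
      rw [span_univDer]; exact Submodule.mem_top
    induction hx using Submodule.span_induction with
    | mem x hx => obtain ⟨k, rfl⟩ := hx; exact Algebra.subset_adjoin ⟨k, rfl⟩
    | zero => rw [map_zero]; exact Subalgebra.zero_mem _
    | add x y _ _ hx hy => rw [map_add]; exact Subalgebra.add_mem _ hx hy
    | smul r x _ hx =>
      rw [map_smul, Algebra.smul_def]
      exact Subalgebra.mul_mem _ (hbase r) hx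
  | mul s t hs ht => exact Subalgebra.mul_mem _ hs ht
  | add s t hs ht => exact Subalgebra.add_mem _ hs ht

/-- Every morphism to `Proj S(Ω_G)` factors locally through a chart. -/
theorem exists_chartMor_eq (f : X ⟶ ProjSym (CoordRing G) (Omega G)) (x : X) :
    ∃ (V : X.Opens) (_ : x ∈ V) (g : G) (φ : ChartRing G g →+* Γ(V, ⊤)),
      chartMor φ = V.ι ≫ f := by
  have hcov := Proj.iSup_basicOpen_eq_top' (symGrading (CoordRing G) (Omega G)) (symDer G)
    (fun g => ⟨1, symDer_mem g⟩) adjoin_symDer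
  obtain ⟨g, hg⟩ := Opens.mem_iSup.1 (hcov.ge (Set.mem_univ (f x)))
  let U : (ProjSym (CoordRing G) (Omega G)).Opens :=
    Proj.basicOpen (symGrading (CoordRing G) (Omega G)) (symDer G g)
  let V : X.Opens := f ⁻¹ᵁ U
  have hU : (chartι G g).opensRange = U :=
    Proj.opensRange_awayι (symGrading (CoordRing G) (Omega G)) _ (symDer_mem g) one_pos
  have hrange : Set.range (V.ι ≫ f) ⊆ Set.range (chartι G g) := by
    rintro _ ⟨y, rfl⟩
    have hy : f (V.ι y) ∈ (chartι G g).opensRange := by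
      rw [hU]; exact y.2
    rw [Scheme.Hom.comp_apply]
    exact hy
  obtain ⟨φ, hφ⟩ := (specMor_bijective V.toScheme _).2 (IsOpenImmersion.lift (chartι G g) _ hrange)
  exact ⟨V, hg, g, φ, by rw [chartMor, hφ, IsOpenImmersion.lift_fac]⟩

end Morphisms

/-! ### Representability of a sheafification -/

section Sites

variable {C : Type u} [Category.{v} C] (J : GrothendieckTopology C) [J.Subcanonical]

/-- If a relation between the sections of a presheaf `P` and the morphisms to `Y` is stable under
restriction, one-to-one, and everywhere defined locally on either side, then `Y` represents the
sheafification of `P`: the graph of the relation is a presheaf which maps locally bijectively both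
to `P` and to the sheaf represented by `Y`. -/
theorem nonempty_representableBy_sheafify (P : Cᵒᵖ ⥤ Type (max u v)) (Y : C)
    (r : ∀ X : C, P.obj (op X) → (X ⟶ Y) → Prop)
    (map : ∀ {X X' : C} (i : X' ⟶ X) (p : P.obj (op X)) (f : X ⟶ Y), r X p f →
      r X' (P.map i.op p) (i ≫ f))
    (left_unique : ∀ {X : C} {p p' : P.obj (op X)} {f : X ⟶ Y}, r X p f → r X p' f → p = p')
    (right_unique : ∀ {X : C} {p : P.obj (op X)} {f f' : X ⟶ Y}, r X p f → r X p f' → f = f')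
    (left_total : ∀ {X : C} (p : P.obj (op X)), ∃ S ∈ J X, ∀ {X' : C} (i : X' ⟶ X), S i →
      ∃ f, r X' (P.map i.op p) f)
    (right_total : ∀ {X : C} (f : X ⟶ Y), ∃ S ∈ J X, ∀ {X' : C} (i : X' ⟶ X), S i →
      ∃ p, r X' p (i ≫ f)) :
    Nonempty ((sheafify J P).RepresentableBy Y) := by
  let H : Cᵒᵖ ⥤ Type (max u v) := CategoryTheory.yoneda.obj Y ⋙ uliftFunctor.{u, v}
  have hH : Presheaf.IsSheaf J H :=
    ((GrothendieckTopology.uliftYoneda.{u} J).obj Y).property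
  let Q : Cᵒᵖ ⥤ Type (max u v) :=
    { obj X := {q : P.obj X × (X.unop ⟶ Y) // r X.unop q.1 q.2}
      map i := TypeCat.ofHom fun q => ⟨(P.map i q.1.1, i.unop ≫ q.1.2), map i.unop _ _ q.2⟩
      map_id X := by
        ext q <;> simp
      map_comp i j := by
        ext q <;> simp }
  let α : Q ⟶ P :=
    { app X := TypeCat.ofHom fun q => q.1.1
      naturality _ _ _ := rfl }
  let β : Q ⟶ H :=
    { app X := TypeCat.ofHom fun q => ULift.up q.1.2
      naturality _ _ _ := rfl }
  have hα : J.W α := by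
    rw [J.W_iff_isLocallyBijective]
    refine ⟨Presheaf.isLocallyInjective_of_injective J α fun X q q' h => ?_, ⟨fun {X} p => ?_⟩⟩
    · have h1 : q.1.1 = q'.1.1 := h
      exact Subtype.ext (Prod.ext h1 (right_unique q.2 (h1 ▸ q'.2)))
    · obtain ⟨S, hS, hS'⟩ := left_total p
      refine J.superset_covering (fun X' i hi => ?_) hS
      obtain ⟨f, hf⟩ := hS' i hi
      exact ⟨⟨(_, f), hf⟩, rfl⟩
  have hβ : J.W β := by
    rw [J.W_iff_isLocallyBijective]
    refine ⟨Presheaf.isLocallyInjective_of_injective J β fun X q q' h => ?_, ⟨fun {X} f => ?_⟩⟩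
    · have h1 : q.1.2 = q'.1.2 := congrArg ULift.down h
      exact Subtype.ext (Prod.ext (left_unique q.2 (h1 ▸ q'.2)) h1)
    · obtain ⟨S, hS, hS'⟩ := right_total f.down
      refine J.superset_covering (fun X' i hi => ?_) hS
      obtain ⟨p, hp⟩ := hS' i hi
      exact ⟨⟨(p, _), hp⟩, rfl⟩
  rw [J.W_iff] at hα hβ
  let e : H ≅ sheafify J P := isoSheafify J hH ≪≫
    (sheafToPresheaf J _).mapIso ((asIso ((presheafToSheaf J _).map β)).symm ≪≫
      asIso ((presheafToSheaf J _).map α))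
  let hrep : H.RepresentableBy Y :=
    { homEquiv := Equiv.ulift.symm
      homEquiv_comp _ _ := rfl }
  exact ⟨hrep.ofIso e⟩

end Sites

/-! ### The moduli functor is represented by `Proj S(Ω_G)` -/

section Representability

variable (G : Type u) [Monoid G]

theorem mem_zariskiTopology_over {S : Scheme.{u}} {X : Over S} (R : Sieve X)
    (h : ∀ x : X.left, ∃ (V : X.left.Opens) (_ : x ∈ V),
      R (Over.homMk V.ι : Over.mk (V.ι ≫ X.hom) ⟶ X)) :
    R ∈ Scheme.zariskiTopology.over S X := by
  rw [GrothendieckTopology.mem_over_iff]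
  choose V hV hR using h
  have hcov : IsOpenCover V := by
    rw [IsOpenCover, eq_top_iff]
    intro x _
    exact Opens.mem_iSup.2 ⟨x, hV x⟩
  refine GrothendieckTopology.superset_covering _ ?_
    (X.left.openCoverOfIsOpenCover V hcov).mem_grothendieckTopology
  refine (Sieve.generate_le_iff _ _).2 ?_
  rintro _ _ ⟨x⟩
  exact (Sieve.overEquiv_iff _ _).2 (hR x)

variable {G}

/-- A class of representations on `X` corresponds to a morphism `X ⟶ Proj S(Ω_G)` if both come
from one point of a chart. -/
def Corresponds (X : Over SpecZHalf.{u}) (p : (preEqU G).obj (op X)) (f : X ⟶ Ch G) : Prop :=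
  ∃ (g : G) (φ : ChartRing G g →+* Γ(X.left, ⊤)),
    p = ULift.up (Quotient.mk (unipotentRepSetoid X.left G)
      ⟨(normalFormOfHom φ).rep, (normalFormOfHom φ).hasUnipotentMold⟩) ∧ f.left = chartMor φ

theorem Corresponds.map {X X' : Over SpecZHalf.{u}} (i : X' ⟶ X) (p : (preEqU G).obj (op X))
    (f : X ⟶ Ch G) (h : Corresponds X p f) :
    Corresponds X' ((preEqU G).map i.op p) (i ≫ f) := by
  obtain ⟨g, φ, rfl, hf⟩ := h
  refine ⟨g, i.left.appTop.hom.comp φ, ?_, ?_⟩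
  · apply congrArg ULift.up
    apply congrArg (Quotient.mk (unipotentRepSetoid X'.left G))
    apply Subtype.ext
    exact NormalForm.mapRep_rep _ _
  · rw [Over.comp_left, hf]
    exact comp_chartMor _ _

theorem Corresponds.left_unique {X : Over SpecZHalf.{u}} {p p' : (preEqU G).obj (op X)}
    {f : X ⟶ Ch G} (h : Corresponds X p f) (h' : Corresponds X p' f) : p = p' := by
  obtain ⟨g, φ, rfl, hf⟩ := h
  obtain ⟨k, ψ, rfl, hf'⟩ := h'
  have hz := nonempty_zHalf_hom X.hom
  apply congrArg ULift.up
  apply Quotient.sound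
  exact (NormalForm.exists_algEquiv_iff (isUnit_two_of_hom hz) _ _).2
    ((chartMor_eq_iff hz φ ψ).1 (hf.symm.trans hf'))

theorem Corresponds.right_unique {X : Over SpecZHalf.{u}} {p : (preEqU G).obj (op X)}
    {f f' : X ⟶ Ch G} (h : Corresponds X p f) (h' : Corresponds X p f') : f = f' := by
  obtain ⟨g, φ, rfl, hf⟩ := h
  obtain ⟨k, ψ, hp, hf'⟩ := h'
  have hz := nonempty_zHalf_hom X.hom
  have heq := Quotient.exact (ULift.up.inj hp)
  apply Over.OverMorphism.ext
  rw [hf, hf']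
  exact (chartMor_eq_iff hz φ ψ).2
    ((NormalForm.exists_algEquiv_iff (isUnit_two_of_hom hz) _ _).1 heq)

theorem exists_corresponds_left {X : Over SpecZHalf.{u}} (p : (preEqU G).obj (op X)) :
    ∃ S ∈ Scheme.zariskiTopology.over SpecZHalf.{u} X, ∀ {X' : Over SpecZHalf.{u}} (i : X' ⟶ X),
      S i → ∃ f, Corresponds X' ((preEqU G).map i.op p) f := by
  let S : Sieve X :=
    { arrows X' i := ∃ f, Corresponds X' ((preEqU G).map i.op p) f
      downward_closed := by
        rintro X' X'' i ⟨f, hf⟩ j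
        refine ⟨j ≫ f, ?_⟩
        have := hf.map j
        rwa [← Functor.map_comp_apply] at this }
  refine ⟨S, mem_zariskiTopology_over S fun x => ?_, fun _ hi => hi⟩
  obtain ⟨p⟩ := p
  obtain ⟨ρ, rfl⟩ := Quotient.exists_rep p
  have hz := nonempty_zHalf_hom X.hom
  obtain ⟨V, hx, a, ha⟩ := exists_normalForm_nhds ρ.2 (isUnit_two_of_hom hz) x
  obtain ⟨φ, hφ⟩ := a.exists_normalFormOfHom (nonempty_zHalf_hom (V.ι ≫ X.hom))
  refine ⟨V, hx, Over.homMk (chartMor φ) (Subsingleton.elim _ _), a.base, φ, ?_, rfl⟩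
  apply congrArg ULift.up
  apply Quotient.sound
  change Equivalent (pullRep V.ι ρ.1) (normalFormOfHom φ).rep
  rw [hφ]
  exact ha

theorem exists_corresponds_right {X : Over SpecZHalf.{u}} (f : X ⟶ Ch G) :
    ∃ S ∈ Scheme.zariskiTopology.over SpecZHalf.{u} X, ∀ {X' : Over SpecZHalf.{u}} (i : X' ⟶ X),
      S i → ∃ p, Corresponds X' p (i ≫ f) := by
  let S : Sieve X :=
    { arrows X' i := ∃ p, Corresponds X' p (i ≫ f)
      downward_closed := by
        rintro X' X'' i ⟨p, hp⟩ j
        refine ⟨(preEqU G).map j.op p, ?_⟩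
        rw [Category.assoc]
        exact hp.map j }
  refine ⟨S, mem_zariskiTopology_over S fun x => ?_, fun _ hi => hi⟩
  obtain ⟨V, hx, g, φ, hφ⟩ := exists_chartMor_eq f.left x
  exact ⟨V, hx, _, g, φ, rfl, hφ.symm⟩

variable (G) in
theorem nonempty_representableBy : Nonempty ((EqU G).RepresentableBy (Ch G)) :=
  nonempty_representableBy_sheafify (Scheme.zariskiTopology.{u}.over SpecZHalf.{u}) (preEqU G)
    (Ch G) Corresponds Corresponds.map Corresponds.left_unique Corresponds.right_unique
    exists_corresponds_left exists_corresponds_right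

end Representability

/-! ### Separatedness and finiteness -/

section Finiteness

variable (G : Type u) [Monoid G]

/-- The subalgebra `A` generated by the values of the universal character carries a character, so
the universal property retracts the coordinate ring onto it. -/
theorem adjoin_univChar : Algebra.adjoin ZHalf.{u} (Set.range (univChar G)) = ⊤ := by
  let A := Algebra.adjoin ZHalf.{u} (Set.range (univChar G))
  let r : G →* A :=
    { toFun g := ⟨univChar G g, Algebra.subset_adjoin ⟨g, rfl⟩⟩
      map_one' := Subtype.ext (map_one _)
      map_mul' g h := Subtype.ext (map_mul _ g h) }
  obtain ⟨φ, hφ, -⟩ := univChar_universal G r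
  have h : (A.val.comp φ) = AlgHom.id _ _ :=
    (univChar_universal G (univChar G)).unique (fun g => congrArg Subtype.val (hφ g))
      (fun _ => rfl)
  rw [eq_top_iff]
  rintro x -
  have hx := DFunLike.congr_fun h x
  have hmem : A.val (φ x) ∈ A := (φ x).2
  have hx' : A.val (φ x) = x := hx
  rwa [hx'] at hmem

theorem finiteType_coordRing [hG : Monoid.FG G] : Algebra.FiniteType ZHalf.{u} (CoordRing G) := by
  obtain ⟨S, hS, hfin⟩ := (Monoid.fg_iff).1 hG
  refine ⟨Subalgebra.fg_def.2 ⟨univChar G '' S, hfin.image _, ?_⟩⟩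
  rw [eq_top_iff, ← adjoin_univChar, Algebra.adjoin_le_iff]
  rintro _ ⟨g, rfl⟩
  have hg : g ∈ Submonoid.closure S := by rw [hS]; trivial
  induction hg using Submonoid.closure_induction with
  | mem g hg => exact Algebra.subset_adjoin ⟨g, hg, rfl⟩
  | one => rw [map_one]; exact Subalgebra.one_mem _
  | mul g h _ _ hg hh => rw [map_mul]; exact Subalgebra.mul_mem _ hg hh

theorem finite_omega [hG : Monoid.FG G] : Module.Finite (CoordRing G) (Omega G) := by
  obtain ⟨S, hS, hfin⟩ := (Monoid.fg_iff).1 hG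
  refine ⟨(Submodule.fg_def).2 ⟨univDer G '' S, hfin.image _, ?_⟩⟩
  rw [eq_top_iff, ← span_univDer, Submodule.span_le]
  rintro _ ⟨g, rfl⟩
  have hg : g ∈ Submonoid.closure S := by rw [hS]; trivial
  induction hg using Submonoid.closure_induction with
  | mem g hg => exact Submodule.subset_span ⟨g, hg, rfl⟩
  | one =>
    have h : univDer G 1 = 0 := by simpa using isDerivation_univDer G 1 1
    rw [h]; exact Submodule.zero_mem _
  | mul g h _ _ hg hh =>
    rw [isDerivation_univDer G g h]
    exact Submodule.add_mem _ (Submodule.smul_mem _ _ hh) (Submodule.smul_mem _ _ hg)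

theorem finiteType_symmetricAlgebra (R M : Type*) [CommRing R] [AddCommGroup M] [Module R M]
    [hM : Module.Finite R M] : Algebra.FiniteType R (SymmetricAlgebra R M) := by
  obtain ⟨S, hfin, hS⟩ := (Submodule.fg_def).1 hM.fg_top
  refine ⟨Subalgebra.fg_def.2 ⟨SymmetricAlgebra.ι R M '' S, hfin.image _, ?_⟩⟩
  rw [eq_top_iff]
  rintro s -
  induction s using SymmetricAlgebra.induction with
  | algebraMap r => exact Subalgebra.algebraMap_mem _ r
  | ι x =>
    have hx : x ∈ Submodule.span R S := by rw [hS]; trivial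
    induction hx using Submodule.span_induction with
    | mem x hx => exact Algebra.subset_adjoin ⟨x, hx, rfl⟩
    | zero => rw [map_zero]; exact Subalgebra.zero_mem _
    | add x y _ _ hx hy => rw [map_add]; exact Subalgebra.add_mem _ hx hy
    | smul r x _ hx => rw [map_smul]; exact Subalgebra.smul_mem _ hx r
  | mul s t hs ht => exact Subalgebra.mul_mem _ hs ht
  | add s t hs ht => exact Subalgebra.add_mem _ hs ht

theorem algebraMap_symGrading_zero_surjective (R M : Type*) [CommRing R] [AddCommGroup M]
    [Module R M] : Function.Surjective (algebraMap R (symGrading R M 0)) := by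
  rintro ⟨s, hs⟩
  have hs' : s ∈ LinearMap.range (SymmetricAlgebra.ι R M) ^ 0 := hs
  rw [pow_zero] at hs'
  obtain ⟨r, rfl⟩ := Submodule.mem_one.1 hs'
  exact ⟨r, rfl⟩

theorem finiteType_symGrading_zero (R M : Type*) [CommRing R] [AddCommGroup M] [Module R M]
    [Module.Finite R M] : Algebra.FiniteType (symGrading R M 0) (SymmetricAlgebra R M) := by
  have := finiteType_symmetricAlgebra R M
  have : IsScalarTower R (symGrading R M 0) (SymmetricAlgebra R M) :=
    IsScalarTower.of_algebraMap_eq (R := R) (S := symGrading R M 0) (A := SymmetricAlgebra R M)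
      fun _ => rfl
  exact Algebra.FiniteType.of_restrictScalars_finiteType R _ _

variable {R M : Type u} [CommRing R] [AddCommGroup M] [Module R M]

instance : IsSeparated (ProjSym.toSpec R M) :=
  inferInstanceAs (IsSeparated (Proj.toSpecZero (symGrading R M) ≫ _))

instance [Module.Finite R M] : LocallyOfFiniteType (ProjSym.toSpec R M) := by
  have := finiteType_symGrading_zero R M
  have : LocallyOfFiniteType
      (Spec.map (CommRingCat.ofHom (algebraMap R (symGrading R M 0)))) :=
    (HasRingHomProperty.Spec_iff (P := @LocallyOfFiniteType)).2
      (RingHom.FiniteType.of_surjective _ (algebraMap_symGrading_zero_surjective R M))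
  exact inferInstanceAs (LocallyOfFiniteType (Proj.toSpecZero (symGrading R M) ≫ _))

instance [Module.Finite R M] : QuasiCompact (ProjSym.toSpec R M) := by
  have := finiteType_symGrading_zero R M
  exact inferInstanceAs (QuasiCompact (Proj.toSpecZero (symGrading R M) ≫ _))

theorem isSeparated_ch : IsSeparated (Ch G).hom :=
  inferInstanceAs (IsSeparated (ProjSym.toSpec (CoordRing G) (Omega G) ≫ _))

theorem locallyOfFiniteType_ch [Monoid.FG G] : LocallyOfFiniteType (Ch G).hom := by
  have := finite_omega G
  have : LocallyOfFiniteType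
      (Spec.map (CommRingCat.ofHom (algebraMap ZHalf.{u} (CoordRing G)))) :=
    (HasRingHomProperty.Spec_iff (P := @LocallyOfFiniteType)).2
      ((RingHom.finiteType_algebraMap).2 (finiteType_coordRing G))
  exact inferInstanceAs (LocallyOfFiniteType (ProjSym.toSpec (CoordRing G) (Omega G) ≫ _))

theorem quasiCompact_ch [Monoid.FG G] : QuasiCompact (Ch G).hom := by
  have := finite_omega G
  exact inferInstanceAs (QuasiCompact (ProjSym.toSpec (CoordRing G) (Omega G) ≫ _))

end Finiteness

end UnipotentMold

end

theorem mainTheorem2 (G : Type u) [Monoid G] :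
    Nonempty ((UnipotentMold.EqU G).RepresentableBy (UnipotentMold.Ch G)) ∧
    IsSeparated (UnipotentMold.Ch G).hom ∧
    (Monoid.FG G →
      LocallyOfFiniteType (UnipotentMold.Ch G).hom ∧ QuasiCompact (UnipotentMold.Ch G).hom) :=
  ⟨UnipotentMold.nonempty_representableBy G, UnipotentMold.isSeparated_ch G, fun _ =>
    ⟨UnipotentMold.locallyOfFiniteType_ch G, UnipotentMold.quasiCompact_ch G⟩⟩
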